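/- Let $\chi_5(n)=\left(\frac{n}{5}\right)$ be the Legendre symbol modulo $5$. For $n\ge 0$ define $$p_5(n)=\sum_{\pi}\chi_5(a_1)\cdots\chi_5(a_k),\qquad p_5^{\dagger}(n)=\sum_{\pi}(-1)^k\chi_5(a_1)\cdots\chi_5(a_k),$$ where both sums run over all partitions $\pi=(a_1,\ldots,a_k)$ of $n$. Then, for all $j\ge 0$, $$p_5(10j+2)=0\qquad\text{and}\qquad p_5^{\dagger}(10j+6)=0 .$$ Moreover, for complex $q$ with $|q|<1$ write $(z;q)=\prod_{n\ge 0}(1-zq^n)$ and $(z_1,\ldots,z_m;q)=(z_1;q)\cdots(z_m;q)$, and put $$X(q)=(q,-q^2,-q^3,q^4;q^5),\qquad Y(q)=(-q,q^2,q^3,-q^4;q^5).$$ Then for $|q|<1$ one has $X(q)\neq 0$, $Y(q)\ne 0$ and $$\frac1{X(q)}=\sum_{n\ge 0}p_5(n)q^n,\qquad \frac1{Y(q)}=\sum_{n\ge 0}p_5^{\dagger}(n)q^n .$$ Hence, writing $[f]_{[r]}(q)=\sum_{j\ge 0}a_{10j+r}q^{10j}$ for the type-10 components ($0\le r\le 9$)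 of a power series $f(q)=\sum_{n\ge0}a_nq^n$, the vanishing above is equivalent to $$\left[\frac1X\right]_{[2]}=0\qquad\text{and}\qquad\left[\frac1Y\right]_{[6]}=0\qquad(|q|<1).$$ -/

import Mathlib

namespace LegendrePartitions

instance factPrimeFive : Fact (Nat.Prime 5) := ⟨by norm_num⟩

/-- The Legendre symbol `n ↦ (n / 5)`. -/
def chi5 (n : ℕ) : ℤ := legendreSym 5 (n : ℤ)

/-- The Legendre-signed partition numbers: the sum over all partitions of `n` of the product
of the values of `chi5` at the parts, with multiplicity. -/
def p5 (n : ℕ) : ℤ := ∑ π : Nat.Partition n, (π.parts.map chi5).prod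

/-- The same sum with the extra sign `(-1) ^ (number of parts)`. -/
def p5Dagger (n : ℕ) : ℤ :=
  ∑ π : Nat.Partition n, (-1) ^ Multiset.card π.parts * (π.parts.map chi5).prod

noncomputable section

/-- The infinite product `(z; q) = ∏_{n ≥ 0} (1 - z q ^ n)`. -/
def qPoch (z q : ℂ) : ℂ := ∏' n : ℕ, (1 - z * q ^ n)

/-- The product `X(q) = (q, -q², -q³, q⁴; q⁵)`. -/
def X (q : ℂ) : ℂ :=
  qPoch q (q ^ 5) * qPoch (-q ^ 2) (q ^ 5) * qPoch (-q ^ 3) (q ^ 5) * qPoch (q ^ 4) (q ^ 5)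

/-- The product `Y(q) = (-q, q², q³, -q⁴; q⁵)`. -/
def Y (q : ℂ) : ℂ :=
  qPoch (-q) (q ^ 5) * qPoch (q ^ 2) (q ^ 5) * qPoch (q ^ 3) (q ^ 5) * qPoch (-q ^ 4) (q ^ 5)

/-- The coefficient of `q ^ n` in the expansion of `f` as a power series at `0`. -/
def qCoeff (f : ℂ → ℂ) (n : ℕ) : ℂ := iteratedDeriv n f 0 / (n.factorial : ℂ)

/-- The type-10 component `[f]_{[r]}(q) = ∑_{j ≥ 0} a_{10 j + r} q ^ (10 j)` of a series
`f(q) = ∑_{n ≥ 0} a_n q ^ n`. -/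
def component (f : ℂ → ℂ) (r : ℕ) (q : ℂ) : ℂ := ∑' j : ℕ, qCoeff f (10 * j + r) * q ^ (10 * j)

end

end LegendrePartitions

open PowerSeries Finset Filter
open scoped PowerSeries.WithPiTopology Topology

namespace QSeries

/-! ### Generating series over graded index sets -/

section WeightedSeries

variable {ι κ : Type*}

/-! Write f(a,b) for Ramanujan's theta series, the sum of a^(m(m+1)/2) b^(m(m-1)/2) over integers m.
The two partition sums are the coefficients of 1/X and 1/Y, since weighting a part i by c(i)
contributes the factor 1/(1 - c(i) q^i).

For 1/X, split all products modulo 10 and use Euler's identity with multiples of five omitted. With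
the Jacobi triple product this gives (1/X) (q^4, q^6; q^10) (q^10; q^10)^2 = f(-q^3,-q^7) f(q,q^9)
(-q^4, -q^6; q^10). In the even part only the theta product changes. Rotating the lattice of index
pairs of equal parity turns it into f(-q^4,-q^16) f(-q^8,-q^12). The triple product for the second
factor cancels (q^4, q^6; q^10), leaving (even part of 1/X) (q^10; q^10)^4 = f(-q^4,-q^16)
f(q^4,q^6)^2 (q^20; q^20). The outer products are series in q^10, so it suffices that the ternary
theta product has no terms with exponent 2 modulo 10. On those terms a reflection of the index
lattice preserves the exponent and flips the sign.

For 1/Y the roles of the two even theta factors are exchanged, and f(-q^8,-q^12) f(q^2,q^8)^2 has no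
exponents 6 modulo 10.

This is all formal. The analytic claims follow by dominated convergence, with ordinary partition
numbers as majorant, and by uniqueness of Taylor coefficients. -/

/-- The generating series of the weights `w` graded by the exponents `e`. -/
noncomputable def weightedSeries (e : ι → ℕ) (w : ι → ℤ) : ℤ⟦X⟧ :=
  PowerSeries.mk fun n => ∑ᶠ i ∈ e ⁻¹' {n}, w i

/-- The finite set `s` exhausts the fibre, so the default value of `finsum` on infinite supports
plays no role. -/
theorem coeff_weightedSeries {e : ι → ℕ} (w : ι → ℤ) {n : ℕ} {s : Finset ι}
    (hs : ∀ i, i ∈ s ↔ e i = n) : coeff n (weightedSeries e w) = ∑ i ∈ s, w i := by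
  have : e ⁻¹' {n} = (s : Set ι) := by ext i; simp [hs]
  rw [weightedSeries, coeff_mk, this, finsum_mem_coe_finset]

theorem finite_fibers_add {e : ι → ℕ} {f : κ → ℕ} (he : ∀ n, (e ⁻¹' {n}).Finite)
    (hf : ∀ n, (f ⁻¹' {n}).Finite) (n : ℕ) :
    ((fun p : ι × κ => e p.1 + f p.2) ⁻¹' {n}).Finite := by
  have h1 : (⋃ k ∈ Set.Iic n, e ⁻¹' {k}).Finite := (Set.finite_Iic n).biUnion fun k _ => he k
  have h2 : (⋃ k ∈ Set.Iic n, f ⁻¹' {k}).Finite := (Set.finite_Iic n).biUnion fun k _ => hf k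
  refine (h1.prod h2).subset ?_
  rintro ⟨i, j⟩ h
  simp only [Set.mem_preimage, Set.mem_singleton_iff] at h
  simp only [Set.mem_prod, Set.mem_iUnion, Set.mem_preimage, Set.mem_singleton_iff, Set.mem_Iic]
  exact ⟨⟨e i, by omega, rfl⟩, ⟨f j, by omega, rfl⟩⟩

theorem weightedSeries_mul {e : ι → ℕ} {f : κ → ℕ} (he : ∀ n, (e ⁻¹' {n}).Finite)
    (hf : ∀ n, (f ⁻¹' {n}).Finite) (v : ι → ℤ) (w : κ → ℤ) :
    weightedSeries e v * weightedSeries f w =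
      weightedSeries (fun p : ι × κ => e p.1 + f p.2) (fun p => v p.1 * w p.2) := by
  ext n
  rw [coeff_mul, coeff_weightedSeries (s := (finite_fibers_add he hf n).toFinset) _ (by simp)]
  have h1 : ∀ k, coeff k (weightedSeries e v) = ∑ i ∈ (he k).toFinset, v i :=
    fun k => coeff_weightedSeries _ (by simp)
  have h2 : ∀ k, coeff k (weightedSeries f w) = ∑ i ∈ (hf k).toFinset, w i :=
    fun k => coeff_weightedSeries _ (by simp)
  simp_rw [h1, h2, sum_mul_sum, ← sum_product']
  rw [sum_sigma']
  refine sum_bij' (fun x _ => x.2) (fun p _ => ⟨(e p.1, f p.2), p⟩) ?_ ?_ ?_ ?_ ?_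
  · rintro ⟨⟨a, b⟩, i, j⟩ h
    simp_all
  · rintro ⟨i, j⟩ h
    simp_all
  · rintro ⟨⟨a, b⟩, i, j⟩ h
    simp at h
    obtain ⟨-, rfl, rfl⟩ := h
    rfl
  · rintro ⟨i, j⟩ h
    rfl
  · rintro ⟨⟨a, b⟩, i, j⟩ h
    rfl

theorem coeff_weightedSeries_eq_zero_of_involution {e : ι → ℕ} {w : ι → ℤ} {n : ℕ}
    (he : (e ⁻¹' {n}).Finite) (g : ι → ι) (hg : ∀ i, e i = n → e (g i) = n)
    (hgg : ∀ i, e i = n → g (g i) = i) (hw : ∀ i, e i = n → w (g i) = -w i) :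
    coeff n (weightedSeries e w) = 0 := by
  rw [coeff_weightedSeries (s := he.toFinset) _ (by simp)]
  have h : ∑ i ∈ he.toFinset, w i = ∑ i ∈ he.toFinset, -w i := by
    refine sum_bij' (fun i _ => g i) (fun i _ => g i) ?_ ?_ ?_ ?_ ?_
    all_goals
      intro i hi
      have hi : e i = n := by simpa using hi
    · simpa using hg i hi
    · simpa using hg i hi
    · exact hgg i hi
    · exact hgg i hi
    · rw [hw i hi, neg_neg]
  rw [sum_neg_distrib] at h
  omega

end WeightedSeries

/-! ### Extraction of residue classes of exponents -/

section Dissection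

/-- The part of a power series supported on the exponents that are `r` modulo `m`. -/
noncomputable def residuePart (m r : ℕ) (F : ℤ⟦X⟧) : ℤ⟦X⟧ :=
  PowerSeries.mk fun n => if n % m = r then coeff n F else 0

theorem coeff_residuePart (m r n : ℕ) (F : ℤ⟦X⟧) :
    coeff n (residuePart m r F) = if n % m = r then coeff n F else 0 := coeff_mk _ _

/-- The series in `X ^ m`. -/
def multiplesSubring (m : ℕ) : Subring ℤ⟦X⟧ where
  carrier := {F | ∀ n, ¬ m ∣ n → coeff n F = 0}
  zero_mem' := by intro n _; simp
  one_mem' := by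
    intro n hn
    rw [coeff_one, if_neg]
    rintro rfl
    simp at hn
  add_mem' := by
    intro F G hF hG n hn
    rw [map_add, hF n hn, hG n hn, add_zero]
  neg_mem' := by
    intro F hF n hn
    rw [map_neg, hF n hn, neg_zero]
  mul_mem' := by
    intro F G hF hG n hn
    rw [coeff_mul]
    refine sum_eq_zero fun p hp => ?_
    rw [HasAntidiagonal.mem_antidiagonal] at hp
    by_cases h1 : m ∣ p.1
    · have h2 : ¬ m ∣ p.2 := fun h2 => hn (hp ▸ dvd_add h1 h2)
      rw [hG _ h2, mul_zero]
    · rw [hF _ h1, zero_mul]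

/-- Multiplying by a series in `X ^ m` leaves every exponent in its class modulo `m`. -/
theorem residuePart_mul {m : ℕ} (r : ℕ) (F : ℤ⟦X⟧) {G : ℤ⟦X⟧} (hG : G ∈ multiplesSubring m) :
    residuePart m r (F * G) = residuePart m r F * G := by
  ext n
  have key : ∀ p ∈ antidiagonal n, coeff p.1 (residuePart m r F) * coeff p.2 G =
      if n % m = r then coeff p.1 F * coeff p.2 G else 0 := by
    intro p hp
    rw [HasAntidiagonal.mem_antidiagonal] at hp
    rw [coeff_residuePart]
    by_cases h : m ∣ p.2
    · obtain ⟨k, hk⟩ := h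
      have : p.1 % m = n % m := by rw [← hp, hk, Nat.add_mul_mod_self_left]
      rw [this]
      split_ifs <;> simp
    · rw [hG _ h]
      simp
  rw [coeff_residuePart, coeff_mul, coeff_mul, sum_congr rfl key]
  split_ifs <;> simp

/-- Here `φ` parametrizes exactly the indices whose exponent lies in the class; for theta products
it is the inclusion of a sublattice. -/
theorem residuePart_weightedSeries {ι κ : Type*} {e : ι → ℕ} {f : κ → ℕ} {v : ι → ℤ} {w : κ → ℤ}
    {m r : ℕ} (he : ∀ n, (e ⁻¹' {n}).Finite) (φ : κ → ι)
    (hφ : Function.Injective φ) (hf : ∀ k, e (φ k) = f k) (hw : ∀ k, v (φ k) = w k)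
    (hr : ∀ i, e i % m = r ↔ i ∈ Set.range φ) :
    residuePart m r (weightedSeries e v) = weightedSeries f w := by
  ext n
  have hfin : (f ⁻¹' {n}).Finite := by
    have : f ⁻¹' {n} = φ ⁻¹' (e ⁻¹' {n}) := by ext k; simp [hf]
    rw [this]
    exact (he n).preimage hφ.injOn
  rw [coeff_residuePart, coeff_weightedSeries (s := (he n).toFinset) _ (by simp),
    coeff_weightedSeries (s := hfin.toFinset) _ (by simp)]
  split_ifs with h
  · symm
    refine sum_bij (fun k _ => φ k) ?_ ?_ ?_ ?_
    · intro k hk; simp_all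
    · intro a _ b _ h; exact hφ h
    · intro i hi
      simp only [Set.Finite.mem_toFinset, Set.mem_preimage, Set.mem_singleton_iff] at hi
      obtain ⟨k, rfl⟩ := (hr i).1 (hi ▸ h)
      exact ⟨k, by simpa [← hf] using hi, rfl⟩
    · intro k _; exact (hw k).symm
  · symm
    refine sum_eq_zero fun k hk => ?_
    simp only [Set.Finite.mem_toFinset, Set.mem_preimage, Set.mem_singleton_iff] at hk
    exact absurd (by rw [← hk, ← hf]; exact (hr _).2 ⟨k, rfl⟩) h

end Dissection

end QSeries

namespace QSeries

/-! ### Infinite products of formal power series -/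

section Products

/-- The product `∏ (1 - c X ^ (i + d n))` over `n ≥ 0`. -/
noncomputable def qProd (c : ℤ) (i d : ℕ) : ℤ⟦X⟧ := ∏' n : ℕ, (1 - (c : ℤ⟦X⟧) * X ^ (i + d * n))

theorem multipliable_one_sub_of_le {f : ℕ → ℤ⟦X⟧} (h : ∀ n, X ^ n ∣ f n) :
    Multipliable fun n => 1 - f n := by
  simp_rw [sub_eq_add_neg]
  refine WithPiTopology.multipliable_one_add_of_tendsto_order_atTop_nhds_top _ ?_
  refine ENat.tendsto_nhds_top_iff_natCast_lt.mpr fun n => eventually_atTop.mpr ⟨n + 1, ?_⟩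
  intro k hk
  rw [order_neg]
  refine lt_of_lt_of_le (by exact_mod_cast hk) (nat_le_order (f k) k (X_pow_dvd_iff.1 (h k)))

variable {d : ℕ}

theorem multipliable_qProd (c : ℤ) (i : ℕ) (hd : 0 < d) :
    Multipliable fun n : ℕ => 1 - (c : ℤ⟦X⟧) * X ^ (i + d * n) := by
  refine multipliable_one_sub_of_le fun n => Dvd.dvd.mul_left (pow_dvd_pow _ ?_) _
  nlinarith

theorem qProd_split (c : ℤ) (i : ℕ) (hd : 0 < d) :
    qProd c i d = qProd c i (2 * d) * qProd c (i + d) (2 * d) := by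
  have h1 := multipliable_qProd c i (d := 2 * d) (by omega)
  have h2 := multipliable_qProd c (i + d) (d := 2 * d) (by omega)
  have e1 : ∀ n, i + 2 * d * n = i + d * (2 * n) := fun n => by ring
  have e2 : ∀ n, i + d + 2 * d * n = i + d * (2 * n + 1) := fun n => by ring
  simp_rw [e1] at h1
  simp_rw [e2] at h2
  have := tprod_even_mul_odd (f := fun n => 1 - (c : ℤ⟦X⟧) * X ^ (i + d * n)) h1 h2
  simp_rw [qProd, e1, e2]
  exact this.symm

theorem qProd_one_mul_neg_one (i : ℕ) (hd : 0 < d) :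
    qProd 1 i d * qProd (-1) i d = qProd 1 (2 * i) (2 * d) := by
  rw [qProd, qProd, ← (multipliable_qProd 1 i hd).tprod_mul (multipliable_qProd (-1) i hd), qProd]
  refine tprod_congr fun n => ?_
  push_cast
  have : 2 * i + 2 * d * n = (i + d * n) * 2 := by ring
  rw [this, pow_mul]
  ring

/-- Since ℤ is discrete, convergence means that each coefficient is eventually constant. Limits of
products thus become congruences modulo `X ^ N`. -/
theorem exists_X_pow_dvd_sub {f : ℕ → ℤ⟦X⟧} {F : ℤ⟦X⟧} (hf : HasProd f F) (N : ℕ) :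
    ∃ M₀, ∀ M ≥ M₀, X ^ N ∣ (∏ k ∈ range M, f k) - F := by
  have h := (WithPiTopology.tendsto_iff_coeff_tendsto _ _ _ _).1 hf.tendsto_prod_nat
  have h2 : ∀ᶠ M in atTop, ∀ d ∈ range N, coeff d (∏ k ∈ range M, f k) = coeff d F := by
    rw [Filter.eventually_all_finset]
    intro d _
    have := h d
    rw [nhds_discrete, tendsto_pure] at this
    exact this
  obtain ⟨M₀, hM⟩ := eventually_atTop.1 h2
  refine ⟨M₀, fun M hMM => ?_⟩
  rw [X_pow_dvd_iff]
  intro d hd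
  rw [map_sub, hM M hMM d (mem_range.2 hd), sub_self]

theorem hasProd_qProd (c : ℤ) (i : ℕ) (hd : 0 < d) :
    HasProd (fun n : ℕ => 1 - (c : ℤ⟦X⟧) * X ^ (i + d * n)) (qProd c i d) :=
  (multipliable_qProd c i hd).hasProd

theorem prod_mem_multiplesSubring {m : ℕ} {f : ℕ → ℤ⟦X⟧} {F : ℤ⟦X⟧} (hf : HasProd f F)
    (h : ∀ n, f n ∈ multiplesSubring m) : F ∈ multiplesSubring m := by
  intro n hn
  obtain ⟨M₀, hM⟩ := exists_X_pow_dvd_sub hf (n + 1)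
  have h1 := X_pow_dvd_iff.1 (hM M₀ le_rfl) n (by omega)
  rw [map_sub, (prod_mem fun k _ => h k : ∏ k ∈ range M₀, f k ∈ multiplesSubring m) n hn] at h1
  omega

theorem qProd_mem_multiplesSubring {m i : ℕ} (c : ℤ) (hd : 0 < d) (hi : m ∣ i) (hm : m ∣ d) :
    qProd c i d ∈ multiplesSubring m := by
  refine prod_mem_multiplesSubring (hasProd_qProd c i hd) fun n => ?_
  refine sub_mem (one_mem _) (mul_mem (intCast_mem _ _) ?_)
  intro k hk
  rw [coeff_X_pow, if_neg]
  rintro rfl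
  exact hk (dvd_add hi (hm.mul_right n))

theorem constantCoeff_qProd {i : ℕ} (c : ℤ) (hi : 0 < i) (hd : 0 < d) :
    constantCoeff (qProd c i d) = 1 := by
  obtain ⟨M₀, hM⟩ := exists_X_pow_dvd_sub (hasProd_qProd c i hd) 1
  have h1 := X_pow_dvd_iff.1 (hM M₀ le_rfl) 0 (by omega)
  rw [coeff_zero_eq_constantCoeff_apply, map_sub, map_prod, sub_eq_zero] at h1
  rw [← h1]
  refine prod_eq_one fun k _ => ?_
  simp [hi.ne']

theorem isUnit_qProd {i : ℕ} (c : ℤ) (hi : 0 < i) (hd : 0 < d) : IsUnit (qProd c i d) := by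
  rw [isUnit_iff_constantCoeff, constantCoeff_qProd c hi hd]
  exact isUnit_one

end Products

/-! ### Gaussian binomials and the finite q-binomial theorem -/

section GaussBinomial

variable {R : Type*} [CommRing R]

/-- The Gaussian binomial coefficients in the variable `q`. -/
def gaussBinom (q : R) : ℕ → ℕ → R
  | _, 0 => 1
  | 0, _ + 1 => 0
  | n + 1, k + 1 => gaussBinom q n k + q ^ (k + 1) * gaussBinom q n (k + 1)

theorem gaussBinom_zero_right (q : R) (n : ℕ) : gaussBinom q n 0 = 1 := by
  cases n <;> rfl

theorem gaussBinom_succ_succ (q : R) (n k : ℕ) : gaussBinom q (n + 1) (k + 1) =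
    gaussBinom q n k + q ^ (k + 1) * gaussBinom q n (k + 1) := rfl

theorem gaussBinom_eq_zero (q : R) : ∀ {n k : ℕ}, n < k → gaussBinom q n k = 0
  | _, 0, h => absurd h (by omega)
  | 0, _ + 1, _ => rfl
  | n + 1, k + 1, h => by
    rw [gaussBinom_succ_succ, gaussBinom_eq_zero q (by omega), gaussBinom_eq_zero q (by omega)]
    ring

theorem gaussBinom_self (q : R) (n : ℕ) : gaussBinom q n n = 1 := by
  induction n with
  | zero => rfl
  | succ n ih => rw [gaussBinom_succ_succ, ih, gaussBinom_eq_zero q (by omega)]; ring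

/-- The factorial formula for Gaussian binomial coefficients. -/
theorem gaussBinom_mul_prod_mul_prod (q : R) (n m : ℕ) :
    gaussBinom q (n + m) n * (∏ l ∈ range n, (1 - q ^ (l + 1))) *
      (∏ l ∈ range m, (1 - q ^ (l + 1))) = ∏ l ∈ range (n + m), (1 - q ^ (l + 1)) := by
  induction h : n + m generalizing n m with
  | zero =>
    obtain ⟨rfl, rfl⟩ : n = 0 ∧ m = 0 := by omega
    simp [gaussBinom_zero_right]
  | succ N ih =>
    rcases n with _ | n
    · obtain rfl : m = N + 1 := by omega
      simp [gaussBinom_zero_right]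
    rcases m with _ | m
    · obtain rfl : n = N := by omega
      rw [gaussBinom_self]
      simp
    have h1 := ih n (m + 1) (by omega)
    have h2 := ih (n + 1) m (by omega)
    rw [gaussBinom_succ_succ, prod_range_succ _ N]
    have hN : N = n + m + 1 := by omega
    rw [prod_range_succ _ n] at h2 ⊢
    rw [prod_range_succ _ m] at h1 ⊢
    subst hN
    -- The last factor splits as 1 - q^(n+m+2) = (1 - q^(n+1)) + q^(n+1) (1 - q^(m+1)).
    linear_combination (1 - q ^ (n + 1)) * h1 + (q ^ (n + 1) * (1 - q ^ (m + 1))) * h2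

/-- The `q`-binomial theorem. -/
theorem prod_add_mul_pow (q x y : R) (N : ℕ) :
    ∏ k ∈ range N, (y + x * q ^ k) =
      ∑ k ∈ range (N + 1), gaussBinom q N k * q ^ (k.choose 2) * x ^ k * y ^ (N - k) := by
  induction N generalizing x with
  | zero => simp [gaussBinom_zero_right]
  | succ N ih =>
    have h1 : ∏ k ∈ range (N + 1), (y + x * q ^ k) =
        (y + x) * ∏ k ∈ range N, (y + (x * q) * q ^ k) := by
      rw [prod_range_succ', mul_comm]
      simp [pow_succ', mul_assoc]
    rw [h1, ih, add_mul, mul_sum, mul_sum, sum_range_succ' _ (N + 1), sum_range_succ' _ N,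
      sum_range_succ _ N]
    have h2 : ∀ k ∈ range (N + 1), gaussBinom q (N + 1) (k + 1) * q ^ ((k + 1).choose 2) *
        x ^ (k + 1) * y ^ (N + 1 - (k + 1)) =
        x * (gaussBinom q N k * q ^ (k.choose 2) * (x * q) ^ k * y ^ (N - k)) +
        gaussBinom q N (k + 1) * q ^ ((k + 1).choose 2) * (x * q) ^ (k + 1) * y ^ (N - k) := by
      intro k _
      rw [gaussBinom_succ_succ, Nat.choose_succ_succ' k 1, Nat.choose_one_right,
        Nat.add_sub_add_right]
      ring
    rw [sum_congr rfl h2, sum_add_distrib, sum_range_succ _ N, sum_range_succ (fun k =>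
      gaussBinom q N (k + 1) * q ^ ((k + 1).choose 2) * (x * q) ^ (k + 1) * y ^ (N - k)) N,
      gaussBinom_eq_zero q (show N < N + 1 by omega)]
    have h3 : ∀ k ∈ range N, y * (gaussBinom q N (k + 1) * q ^ ((k + 1).choose 2) *
        (x * q) ^ (k + 1) * y ^ (N - (k + 1))) =
        gaussBinom q N (k + 1) * q ^ ((k + 1).choose 2) * (x * q) ^ (k + 1) * y ^ (N - k) := by
      intro k hk
      have : N - k = N - (k + 1) + 1 := by have := mem_range.1 hk; omega
      rw [this]
      ring
    rw [sum_congr rfl h3]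
    simp [gaussBinom_zero_right]
    ring

end GaussBinomial

end QSeries

namespace QSeries

/-! ### Theta series and the Jacobi triple product -/

section TripleProduct

/-- The exponent of `a ^ (m (m + 1) / 2) * b ^ (m (m - 1) / 2)` at `a = X ^ i`, `b = X ^ j`. -/
def thetaExp (i j : ℕ) (m : ℤ) : ℕ := (i * (m * (m + 1) / 2) + j * (m * (m - 1) / 2)).toNat

theorem two_mul_thetaExp (i j : ℕ) (m : ℤ) :
    2 * (thetaExp i j m : ℤ) = i * (m * (m + 1)) + j * (m * (m - 1)) := by
  obtain ⟨a, ha⟩ : (2 : ℤ) ∣ m * (m + 1) := (Int.even_mul_succ_self m).two_dvd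
  obtain ⟨b, hb⟩ : (2 : ℤ) ∣ m * (m - 1) := (Int.even_mul_pred_self m).two_dvd
  have ha0 : 0 ≤ a := by
    have : 0 ≤ m * (m + 1) := by
      rcases le_or_gt 0 m with h | h
      · positivity
      · nlinarith
    omega
  have hb0 : 0 ≤ b := by
    have : 0 ≤ m * (m - 1) := by
      rcases le_or_gt m 0 with h | h
      · nlinarith
      · nlinarith
    omega
  rw [thetaExp, ha, hb, Int.mul_ediv_cancel_left _ two_ne_zero,
    Int.mul_ediv_cancel_left _ two_ne_zero, Int.toNat_of_nonneg (by positivity)]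
  ring

variable {i j : ℕ}

/-- Both m(m+1) and m(m-1) are nonnegative and they add up to 2m². The bound gives finite fibres and
confines the terms of exponent at most N to |m| ≤ N. -/
theorem natAbs_le_thetaExp (hi : 0 < i) (hj : 0 < j) (m : ℤ) : m.natAbs ≤ thetaExp i j m := by
  have h := two_mul_thetaExp i j m
  have hi' : (1 : ℤ) ≤ i := by exact_mod_cast hi
  have hj' : (1 : ℤ) ≤ j := by exact_mod_cast hj
  have h1 : 0 ≤ m * (m + 1) := by
    rcases le_or_gt 0 m with h | h
    · positivity
    · nlinarith
  have h2 : 0 ≤ m * (m - 1) := by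
    rcases le_or_gt m 0 with h | h
    · nlinarith
    · nlinarith
  have h3 : m * (m + 1) + m * (m - 1) ≤ 2 * (thetaExp i j m : ℤ) := by
    rw [h]; nlinarith
  have h4 : |m| ≤ m * m := by
    rw [← abs_mul_abs_self m]
    rcases eq_or_ne m 0 with rfl | hm
    · simp
    · have := abs_pos.2 hm
      nlinarith
  zify
  nlinarith

theorem finite_fibers_thetaExp (hi : 0 < i) (hj : 0 < j) (n : ℕ) :
    (thetaExp i j ⁻¹' {n}).Finite := by
  refine (Set.finite_Icc (-(n : ℤ)) n).subset fun m hm => ?_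
  have := natAbs_le_thetaExp hi hj m
  simp only [Set.mem_preimage, Set.mem_singleton_iff] at hm
  rw [Set.mem_Icc]
  omega

/-- The theta series `∑ c ^ m * X ^ (i m (m + 1) / 2 + j m (m - 1) / 2)` over integers `m`,
for a sign `c`. -/
noncomputable def theta (c : ℤ) (i j : ℕ) : ℤ⟦X⟧ :=
  weightedSeries (thetaExp i j) fun m => c ^ m.natAbs

theorem pow_natAbs_sub {c : ℤ} (hc : c * c = 1) (k n : ℕ) :
    c ^ k = c ^ n * c ^ ((k : ℤ) - n).natAbs := by
  rcases le_total n k with h | h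
  · rw [← pow_add]
    congr 1
    omega
  · have h1 : n = k + ((k : ℤ) - n).natAbs := by omega
    generalize ((k : ℤ) - n).natAbs = l at *
    rw [h1, pow_add, mul_assoc, ← mul_pow, hc, one_pow, mul_one]

theorem two_mul_choose_two (k : ℕ) : 2 * (k.choose 2 : ℤ) = k * (k - 1) := by
  have h1 := Nat.choose_two_right k
  have h2 := (Nat.even_mul_pred_self k).two_dvd
  have h3 : 2 * k.choose 2 = k * (k - 1) := by omega
  rcases k with _ | k
  · simp
  · simp only [Nat.add_sub_cancel] at h3
    push_cast
    rw [add_sub_cancel_right]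
    exact_mod_cast h3

/-- The finite form of the Jacobi triple product. -/
theorem prod_mul_prod_eq_sum_gaussBinom {c : ℤ} (hc : c * c = 1) (n : ℕ) :
    (∏ k ∈ range n, (1 + (c : ℤ⟦X⟧) * X ^ (i + (i + j) * k))) *
      (∏ k ∈ range n, (1 + (c : ℤ⟦X⟧) * X ^ (j + (i + j) * k))) =
    ∑ k ∈ range (2 * n + 1), gaussBinom ((X : ℤ⟦X⟧) ^ (i + j)) (2 * n) k *
      ((c : ℤ⟦X⟧) ^ ((k : ℤ) - n).natAbs * X ^ thetaExp i j (k - n)) := by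
  set Q : ℤ⟦X⟧ := X ^ (i + j) with hQ
  set a : ℤ⟦X⟧ := (c : ℤ⟦X⟧) * X ^ i with ha
  have hcc : (c : ℤ⟦X⟧) * c = 1 := by exact_mod_cast congrArg (Int.cast : ℤ → ℤ⟦X⟧) hc
  have hab : a * ((c : ℤ⟦X⟧) * X ^ j) = Q := by
    rw [ha, hQ, pow_add]
    linear_combination (X ^ i * X ^ j) * hcc
  -- Taking y = Q^n in the homogeneous form avoids negative powers of Q. Of the 2n factors, the
  -- lower half gives the product in j (after reversal, using Q = a · c X^j) and the upper half the
  -- product in i.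
  have h := prod_add_mul_pow Q a (Q ^ n) (2 * n)
  have h1 : ∏ k ∈ range (2 * n), (Q ^ n + a * Q ^ k) = (a ^ n * Q ^ (n.choose 2 + n * n)) *
      ((∏ k ∈ range n, (1 + (c : ℤ⟦X⟧) * X ^ (i + (i + j) * k))) *
      (∏ k ∈ range n, (1 + (c : ℤ⟦X⟧) * X ^ (j + (i + j) * k)))) := by
    have h2 : ∏ k ∈ range n, (Q ^ n + a * Q ^ k) =
        (a ^ n * Q ^ (n.choose 2)) * ∏ k ∈ range n, (1 + (c : ℤ⟦X⟧) * X ^ (j + (i + j) * k)) := by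
      rw [← prod_range_reflect]
      have : a ^ n * Q ^ (n.choose 2) = ∏ k ∈ range n, (a * Q ^ (n - 1 - k)) := by
        rw [prod_mul_distrib, prod_const, card_range, prod_range_reflect (fun k => Q ^ k),
          prod_pow_eq_pow_sum, sum_range_id, Nat.choose_two_right]
      rw [this, ← prod_mul_distrib]
      refine prod_congr rfl fun k hk => ?_
      have hk : n = (n - 1 - k) + k + 1 := by have := mem_range.1 hk; omega
      have e : Q ^ n = Q ^ (n - 1 - k) * Q ^ k * Q := by
        rw [← pow_add, ← pow_succ, ← hk]
      rw [e, pow_add _ j, pow_mul, ← hQ]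
      linear_combination -(Q ^ (n - 1 - k) * Q ^ k) * hab
    have h3 : ∏ k ∈ range n, (Q ^ n + a * Q ^ (n + k)) =
        Q ^ (n * n) * ∏ k ∈ range n, (1 + (c : ℤ⟦X⟧) * X ^ (i + (i + j) * k)) := by
      have : Q ^ (n * n) = ∏ k ∈ range n, Q ^ n := by simp [pow_mul]
      rw [this, ← prod_mul_distrib]
      refine prod_congr rfl fun k hk => ?_
      rw [pow_add _ i, pow_mul, ← hQ]
      ring
    rw [two_mul, prod_range_add, h2, h3]
    ring
  have h4 : ∀ k ∈ range (2 * n + 1), gaussBinom Q (2 * n) k * Q ^ (k.choose 2) * a ^ k *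
      (Q ^ n) ^ (2 * n - k) = (a ^ n * Q ^ (n.choose 2 + n * n)) * (gaussBinom Q (2 * n) k *
      ((c : ℤ⟦X⟧) ^ ((k : ℤ) - n).natAbs * X ^ thetaExp i j (k - n))) := by
    intro k hk
    have hk : k ≤ 2 * n := by have := mem_range.1 hk; omega
    have e : (i + j) * k.choose 2 + i * k + (i + j) * (n * (2 * n - k)) =
        i * n + (i + j) * (n.choose 2 + n * n) + thetaExp i j (k - n) := by
      have t := two_mul_thetaExp i j (k - n)
      have ck := two_mul_choose_two k
      have cn := two_mul_choose_two n
      zify [hk]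
      refine mul_left_cancel₀ (two_ne_zero (α := ℤ)) ?_
      linear_combination ((i : ℤ) + j) * ck - ((i : ℤ) + j) * cn - t
    have hck : (c : ℤ⟦X⟧) ^ k = c ^ n * c ^ ((k : ℤ) - n).natAbs := by
      exact_mod_cast congrArg (Int.cast : ℤ → ℤ⟦X⟧) (pow_natAbs_sub hc k n)
    have hX : Q ^ (k.choose 2) * (X ^ i) ^ k * (Q ^ n) ^ (2 * n - k) =
        (X ^ i) ^ n * Q ^ (n.choose 2 + n * n) * X ^ thetaExp i j (k - n) := by
      rw [hQ]
      simp only [← pow_mul, ← pow_add]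
      rw [← e]
      congr 1
      ring
    rw [ha, mul_pow, mul_pow, hck]
    linear_combination (gaussBinom Q (2 * n) k * c ^ n * c ^ ((k : ℤ) - n).natAbs) * hX
  rw [h1, sum_congr rfl h4, ← mul_sum] at h
  refine mul_left_cancel₀ (mul_ne_zero (pow_ne_zero _ ?_) (pow_ne_zero _ ?_)) h
  · intro h0
    rw [h0, zero_mul] at hab
    exact pow_ne_zero (i + j) X_ne_zero hab.symm
  · exact pow_ne_zero _ X_ne_zero

/-- The Jacobi triple product. -/
theorem qProd_mul_qProd_mul_qProd {c : ℤ} (hc : c * c = 1) (hi : 0 < i) (hj : 0 < j) :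
    qProd (-c) i (i + j) * qProd (-c) j (i + j) * qProd 1 (i + j) (i + j) = theta c i j := by
  have hd : 0 < i + j := by omega
  set P := qProd 1 (i + j) (i + j) with hP
  ext N
  obtain ⟨M₁, h1⟩ := exists_X_pow_dvd_sub (hasProd_qProd (-c) i hd) (N + 1)
  obtain ⟨M₂, h2⟩ := exists_X_pow_dvd_sub (hasProd_qProd (-c) j hd) (N + 1)
  obtain ⟨M₃, h3⟩ := exists_X_pow_dvd_sub (hasProd_qProd 1 (i + j) hd) (N + 1)
  have h3 : ∀ M ≥ M₃, (X : ℤ⟦X⟧) ^ (N + 1) ∣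
      ∏ k ∈ range M, (1 - ((X : ℤ⟦X⟧) ^ (i + j)) ^ (k + 1)) - P := by
    intro M hM
    convert h3 M hM using 3 with k
    rw [← pow_mul, Int.cast_one, one_mul]
    ring_nf
  -- The margin M₃ + N keeps every k with |k - n| ≤ N at distance at least M₃ from both 0 and 2n.
  obtain ⟨n, hn1, hn2, hn3⟩ : ∃ n, M₁ ≤ n ∧ M₂ ≤ n ∧ M₃ + N ≤ n :=
    ⟨M₁ + M₂ + M₃ + N, by omega, by omega, by omega⟩
  have hG : ∀ k, M₃ ≤ k → M₃ + k ≤ 2 * n → (X : ℤ⟦X⟧) ^ (N + 1) ∣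
      P * gaussBinom ((X : ℤ⟦X⟧) ^ (i + j)) (2 * n) k - 1 := by
    intro k hk1 hk2
    obtain ⟨m, hm⟩ : ∃ m, 2 * n = k + m := ⟨2 * n - k, by omega⟩
    have e := gaussBinom_mul_prod_mul_prod ((X : ℤ⟦X⟧) ^ (i + j)) k m
    rw [hm]
    obtain ⟨a, ha⟩ := h3 k hk1
    obtain ⟨b, hb⟩ := h3 m (by omega)
    obtain ⟨r, hr⟩ := h3 (k + m) (by omega)
    rw [sub_eq_iff_eq_add] at ha hb hr
    rw [ha, hb, hr] at e
    -- The factorial formula only gives P² G ≡ P; the unit P is cancelled afterwards.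
    have : (X : ℤ⟦X⟧) ^ (N + 1) ∣
        P * (P * gaussBinom ((X : ℤ⟦X⟧) ^ (i + j)) (k + m) k - 1) := by
      generalize gaussBinom ((X : ℤ⟦X⟧) ^ (i + j)) (k + m) k = G at e ⊢
      refine ⟨r - G * a * P - G * b * P - G * a * b * X ^ (N + 1), ?_⟩
      linear_combination e
    exact (isUnit_qProd 1 hd hd).dvd_mul_left.1 this
  have hF : (X : ℤ⟦X⟧) ^ (N + 1) ∣ qProd (-c) i (i + j) * qProd (-c) j (i + j) * P -
      (∏ k ∈ range n, (1 + (c : ℤ⟦X⟧) * X ^ (i + (i + j) * k))) *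
      (∏ k ∈ range n, (1 + (c : ℤ⟦X⟧) * X ^ (j + (i + j) * k))) * P := by
    obtain ⟨a, ha⟩ := h1 n hn1
    obtain ⟨b, hb⟩ := h2 n hn2
    rw [sub_eq_iff_eq_add] at ha hb
    simp only [Int.cast_neg, neg_mul, sub_neg_eq_add] at ha hb
    rw [ha, hb]
    refine ⟨-(a * b * X ^ (N + 1) + a * qProd (-c) j (i + j) + b * qProd (-c) i (i + j)) * P, ?_⟩
    ring
  have hF' := X_pow_dvd_iff.1 hF N (by omega)
  rw [map_sub, sub_eq_zero, prod_mul_prod_eq_sum_gaussBinom hc, sum_mul, map_sum] at hF'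
  rw [hF']
  have key : ∀ k ∈ range (2 * n + 1), coeff N (gaussBinom ((X : ℤ⟦X⟧) ^ (i + j)) (2 * n) k *
      ((c : ℤ⟦X⟧) ^ ((k : ℤ) - n).natAbs * X ^ thetaExp i j (k - n)) * P) =
      if thetaExp i j (k - n) = N then c ^ ((k : ℤ) - n).natAbs else 0 := by
    intro k hk
    have e : gaussBinom ((X : ℤ⟦X⟧) ^ (i + j)) (2 * n) k *
      ((c : ℤ⟦X⟧) ^ ((k : ℤ) - n).natAbs * X ^ thetaExp i j (k - n)) * P =
      C (c ^ ((k : ℤ) - n).natAbs) * (X ^ thetaExp i j (k - n) *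
        (P * gaussBinom ((X : ℤ⟦X⟧) ^ (i + j)) (2 * n) k)) := by
      rw [map_pow, show (C c : ℤ⟦X⟧) = (c : ℤ⟦X⟧) by simp]
      ring
    rw [e, coeff_C_mul, coeff_X_pow_mul']
    have hk' : k < 2 * n + 1 := mem_range.1 hk
    split_ifs with hle heq heq
    · have := natAbs_le_thetaExp hi hj (k - n)
      have h5 := X_pow_dvd_iff.1 (hG k (by omega) (by omega)) (N - thetaExp i j (k - n)) (by omega)
      rw [map_sub, sub_eq_zero] at h5
      rw [h5, heq]
      simp
    · have := natAbs_le_thetaExp hi hj (k - n)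
      have h5 := X_pow_dvd_iff.1 (hG k (by omega) (by omega)) (N - thetaExp i j (k - n)) (by omega)
      rw [map_sub, sub_eq_zero] at h5
      rw [h5, coeff_one, if_neg (by omega), mul_zero]
    · omega
    · rw [mul_zero]
  rw [sum_congr rfl key, ← sum_filter, theta,
    coeff_weightedSeries (s := (finite_fibers_thetaExp hi hj N).toFinset) _ (by simp)]
  refine sum_bij (fun k _ => (k : ℤ) - n) ?_ ?_ ?_ ?_
  · intro k hk
    simpa using (mem_filter.1 hk).2
  · intro k _ l _ h
    simpa using h
  · intro m hm
    have hm : thetaExp i j m = N := by simpa using hm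
    have h6 := natAbs_le_thetaExp hi hj m
    have e : (((m + n).toNat : ℕ) : ℤ) - n = m := by omega
    exact ⟨(m + n).toNat, by rw [mem_filter, mem_range, e]; exact ⟨by omega, hm⟩, e⟩
  · intro k _
    rfl

end TripleProduct

end QSeries

namespace QSeries

/-! ### Even parts of theta products and sign-reversing reflections -/

section ThetaDissection

theorem neg_one_pow_congr {a b : ℕ} (h : a % 2 = b % 2) : (-1 : ℤ) ^ a = (-1) ^ b := by
  rw [neg_one_pow_eq_pow_mod_two a, neg_one_pow_eq_pow_mod_two b, h]

theorem neg_one_pow_eq_neg {a b : ℕ} (h : a % 2 = (b + 1) % 2) : (-1 : ℤ) ^ a = -(-1) ^ b := by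
  rw [neg_one_pow_congr h, pow_succ, mul_neg_one]

/-- The even part of `f(-q³, -q⁷) f(q, q⁹)`. -/
theorem residuePart_theta_three_seven_mul_theta_one_nine :
    residuePart 2 0 (theta (-1) 3 7 * theta 1 1 9) = theta (-1) 4 16 * theta (-1) 8 12 := by
  have h1 := finite_fibers_thetaExp (i := 3) (j := 7) (by norm_num) (by norm_num)
  have h2 := finite_fibers_thetaExp (i := 1) (j := 9) (by norm_num) (by norm_num)
  have h3 := finite_fibers_thetaExp (i := 4) (j := 16) (by norm_num) (by norm_num)
  have h4 := finite_fibers_thetaExp (i := 8) (j := 12) (by norm_num) (by norm_num)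
  rw [theta, theta, theta, theta, weightedSeries_mul h1 h2, weightedSeries_mul h3 h4]
  refine residuePart_weightedSeries (finite_fibers_add h1 h2)
    (fun p : ℤ × ℤ => (p.1 - p.2, p.1 + p.2)) ?_ ?_ ?_ ?_
  · rintro ⟨a, b⟩ ⟨a', b'⟩ h
    simp only [Prod.mk.injEq] at h ⊢
    omega
  · rintro ⟨a, b⟩
    have e1 := two_mul_thetaExp 3 7 (a - b)
    have e2 := two_mul_thetaExp 1 9 (a + b)
    have e3 := two_mul_thetaExp 4 16 a
    have e4 := two_mul_thetaExp 8 12 b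
    push_cast at e1 e2 e3 e4
    zify
    linarith
  · rintro ⟨a, b⟩
    simp only [one_pow, mul_one]
    rw [← pow_add]
    exact neg_one_pow_congr (by omega)
  · rintro ⟨m, n⟩
    have e1 := two_mul_thetaExp 3 7 m
    have e2 := two_mul_thetaExp 1 9 n
    push_cast at e1 e2
    have e3 : (thetaExp 3 7 m : ℤ) = 5 * (m * m) - 2 * m := by linarith
    have e4 : (thetaExp 1 9 n : ℤ) = 5 * (n * n) - 4 * n := by linarith
    -- Writing m² = 2u - m makes the parity of the exponent linear: it is even exactly when m and n
    -- have equal parity.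
    obtain ⟨u, hu⟩ := (Int.even_mul_succ_self m).two_dvd
    obtain ⟨v, hv⟩ := (Int.even_mul_succ_self n).two_dvd
    have hu : m * m = 2 * u - m := by linarith
    have hv : n * n = 2 * v - n := by linarith
    rw [hu] at e3
    rw [hv] at e4
    constructor
    · intro h
      refine ⟨((m + n) / 2, (n - m) / 2), ?_⟩
      simp only [Prod.mk.injEq]
      simp only at h
      omega
    · rintro ⟨⟨a, b⟩, h⟩
      simp only [Prod.mk.injEq] at h
      simp only
      omega

/-- The even part of `f(-q, -q⁹) f(q³, q⁷)`. -/
theorem residuePart_theta_one_nine_mul_theta_three_seven :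
    residuePart 2 0 (theta (-1) 1 9 * theta 1 3 7) = theta (-1) 4 16 * theta (-1) 8 12 := by
  have h1 := finite_fibers_thetaExp (i := 1) (j := 9) (by norm_num) (by norm_num)
  have h2 := finite_fibers_thetaExp (i := 3) (j := 7) (by norm_num) (by norm_num)
  have h3 := finite_fibers_thetaExp (i := 4) (j := 16) (by norm_num) (by norm_num)
  have h4 := finite_fibers_thetaExp (i := 8) (j := 12) (by norm_num) (by norm_num)
  rw [theta, theta, theta, theta, weightedSeries_mul h1 h2, weightedSeries_mul h3 h4]
  refine residuePart_weightedSeries (finite_fibers_add h1 h2)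
    (fun p : ℤ × ℤ => (p.1 + p.2, p.1 - p.2)) ?_ ?_ ?_ ?_
  · rintro ⟨a, b⟩ ⟨a', b'⟩ h
    simp only [Prod.mk.injEq] at h ⊢
    omega
  · rintro ⟨a, b⟩
    have e1 := two_mul_thetaExp 1 9 (a + b)
    have e2 := two_mul_thetaExp 3 7 (a - b)
    have e3 := two_mul_thetaExp 4 16 a
    have e4 := two_mul_thetaExp 8 12 b
    push_cast at e1 e2 e3 e4
    zify
    linarith
  · rintro ⟨a, b⟩
    simp only [one_pow, mul_one]
    rw [← pow_add]
    exact neg_one_pow_congr (by omega)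
  · rintro ⟨m, n⟩
    have e1 := two_mul_thetaExp 1 9 m
    have e2 := two_mul_thetaExp 3 7 n
    push_cast at e1 e2
    have e3 : (thetaExp 1 9 m : ℤ) = 5 * (m * m) - 4 * m := by linarith
    have e4 : (thetaExp 3 7 n : ℤ) = 5 * (n * n) - 2 * n := by linarith
    obtain ⟨u, hu⟩ := (Int.even_mul_succ_self m).two_dvd
    obtain ⟨v, hv⟩ := (Int.even_mul_succ_self n).two_dvd
    have hu : m * m = 2 * u - m := by linarith
    have hv : n * n = 2 * v - n := by linarith
    rw [hu] at e3
    rw [hv] at e4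
    constructor
    · intro h
      refine ⟨((m + n) / 2, (m - n) / 2), ?_⟩
      simp only [Prod.mk.injEq]
      simp only at h
      omega
    · rintro ⟨⟨a, b⟩, h⟩
      simp only [Prod.mk.injEq] at h
      simp only
      omega

/-- The coefficients of `f(-q⁴, -q¹⁶) f(q⁴, q⁶)²` at exponents `2` modulo `10` vanish. The
involution is the reflection of `ℤ³` along `(1, 2, 2)`. -/
theorem coeff_theta_four_sixteen_mul_theta_four_six_sq {N : ℕ} (hN : N % 10 = 2) :
    coeff N (theta (-1) 4 16 * (theta 1 4 6 * theta 1 4 6)) = 0 := by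
  have h1 := finite_fibers_thetaExp (i := 4) (j := 16) (by norm_num) (by norm_num)
  have h2 := finite_fibers_thetaExp (i := 4) (j := 6) (by norm_num) (by norm_num)
  have h3 := finite_fibers_add h2 h2
  rw [theta, theta, weightedSeries_mul h2 h2, weightedSeries_mul h1 h3]
  have key : ∀ l m n : ℤ, thetaExp 4 16 l + (thetaExp 4 6 m + thetaExp 4 6 n) = N →
      ∃ t, 1 - 2 * l - 2 * (m + n) = 5 * t ∧ t % 2 = 1 ∧
        thetaExp 4 16 (l + t) + (thetaExp 4 6 (m + 2 * t) + thetaExp 4 6 (n + 2 * t)) = N := by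
    intro l m n h
    have e1 := two_mul_thetaExp 4 16 l
    have e2 := two_mul_thetaExp 4 6 m
    have e3 := two_mul_thetaExp 4 6 n
    push_cast at e1 e2 e3
    have e : 10 * (l * l) - 6 * l + 5 * (m * m) - m + 5 * (n * n) - n = N := by
      zify at h
      linarith
    -- The squares drop out modulo 5, leaving l + m + n ≡ 3, which makes this expression divisible
    -- by 5. The quotient t is odd, so the shift l ↦ l + t flips the sign; it becomes -t at the
    -- image, whence an involution.
    obtain ⟨t, ht⟩ : (5 : ℤ) ∣ 1 - 2 * l - 2 * (m + n) := by
      generalize l * l = u at e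
      generalize m * m = v at e
      generalize n * n = w at e
      omega
    refine ⟨t, ht, by omega, ?_⟩
    rw [← h]
    have e4 := two_mul_thetaExp 4 16 (l + t)
    have e5 := two_mul_thetaExp 4 6 (m + 2 * t)
    have e6 := two_mul_thetaExp 4 6 (n + 2 * t)
    push_cast at e4 e5 e6
    zify
    refine mul_left_cancel₀ (two_ne_zero (α := ℤ)) ?_
    linear_combination e4 + e5 + e6 - e1 - e2 - e3 - 20 * t * ht
  refine coeff_weightedSeries_eq_zero_of_involution (finite_fibers_add h1 h3 N)
    (fun p : ℤ × ℤ × ℤ => (p.1 + (1 - 2 * p.1 - 2 * (p.2.1 + p.2.2)) / 5,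
      p.2.1 + 2 * ((1 - 2 * p.1 - 2 * (p.2.1 + p.2.2)) / 5),
      p.2.2 + 2 * ((1 - 2 * p.1 - 2 * (p.2.1 + p.2.2)) / 5))) ?_ ?_ ?_
  all_goals
    rintro ⟨l, m, n⟩ h
    obtain ⟨t, ht, ht2, hN⟩ := key l m n h
    simp only [ht, Int.mul_ediv_cancel_left _ (show (5 : ℤ) ≠ 0 by norm_num)]
  · exact hN
  · simp only [Prod.mk.injEq]
    omega
  · simp only [one_pow, mul_one]
    exact neg_one_pow_eq_neg (by omega)

/-- The coefficients of `f(-q⁸, -q¹²) f(q², q⁸)²` at exponents `6` modulo `10` vanish. The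
involution is the reflection of `ℤ³` along `(1, -2, -2)`. -/
theorem coeff_theta_eight_twelve_mul_theta_two_eight_sq {N : ℕ} (hN : N % 10 = 6) :
    coeff N (theta (-1) 8 12 * (theta 1 2 8 * theta 1 2 8)) = 0 := by
  have h1 := finite_fibers_thetaExp (i := 8) (j := 12) (by norm_num) (by norm_num)
  have h2 := finite_fibers_thetaExp (i := 2) (j := 8) (by norm_num) (by norm_num)
  have h3 := finite_fibers_add h2 h2
  rw [theta, theta, weightedSeries_mul h2 h2, weightedSeries_mul h1 h3]
  have key : ∀ l m n : ℤ, thetaExp 8 12 l + (thetaExp 2 8 m + thetaExp 2 8 n) = N →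
      ∃ t, 2 * (m + n) - 2 * l - 1 = 5 * t ∧ t % 2 = 1 ∧
        thetaExp 8 12 (l + t) + (thetaExp 2 8 (m - 2 * t) + thetaExp 2 8 (n - 2 * t)) = N := by
    intro l m n h
    have e1 := two_mul_thetaExp 8 12 l
    have e2 := two_mul_thetaExp 2 8 m
    have e3 := two_mul_thetaExp 2 8 n
    push_cast at e1 e2 e3
    have e : 10 * (l * l) - 2 * l + 5 * (m * m) - 3 * m + 5 * (n * n) - 3 * n = N := by
      zify at h
      linarith
    obtain ⟨t, ht⟩ : (5 : ℤ) ∣ 2 * (m + n) - 2 * l - 1 := by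
      generalize l * l = u at e
      generalize m * m = v at e
      generalize n * n = w at e
      omega
    refine ⟨t, ht, by omega, ?_⟩
    rw [← h]
    have e4 := two_mul_thetaExp 8 12 (l + t)
    have e5 := two_mul_thetaExp 2 8 (m - 2 * t)
    have e6 := two_mul_thetaExp 2 8 (n - 2 * t)
    push_cast at e4 e5 e6
    zify
    refine mul_left_cancel₀ (two_ne_zero (α := ℤ)) ?_
    linear_combination e4 + e5 + e6 - e1 - e2 - e3 - 20 * t * ht
  refine coeff_weightedSeries_eq_zero_of_involution (finite_fibers_add h1 h3 N)
    (fun p : ℤ × ℤ × ℤ => (p.1 + (2 * (p.2.1 + p.2.2) - 2 * p.1 - 1) / 5,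
      p.2.1 - 2 * ((2 * (p.2.1 + p.2.2) - 2 * p.1 - 1) / 5),
      p.2.2 - 2 * ((2 * (p.2.1 + p.2.2) - 2 * p.1 - 1) / 5))) ?_ ?_ ?_
  all_goals
    rintro ⟨l, m, n⟩ h
    obtain ⟨t, ht, ht2, hN⟩ := key l m n h
    simp only [ht, Int.mul_ediv_cancel_left _ (show (5 : ℤ) ≠ 0 by norm_num)]
  · exact hN
  · simp only [Prod.mk.injEq]
    omega
  · simp only [one_pow, mul_one]
    exact neg_one_pow_eq_neg (by omega)

end ThetaDissection

end QSeries

namespace QSeries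

/-! ### Vanishing coefficients of the two reciprocal products -/

section Vanishing

theorem theta_neg_one {i j : ℕ} (hi : 0 < i) (hj : 0 < j) : theta (-1) i j =
    qProd 1 i (i + j) * qProd 1 j (i + j) * qProd 1 (i + j) (i + j) := by
  simpa using (qProd_mul_qProd_mul_qProd (c := -1) (by norm_num) hi hj).symm

theorem theta_one {i j : ℕ} (hi : 0 < i) (hj : 0 < j) : theta 1 i j =
    qProd (-1) i (i + j) * qProd (-1) j (i + j) * qProd 1 (i + j) (i + j) :=
  (qProd_mul_qProd_mul_qProd (c := 1) (by norm_num) hi hj).symm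

theorem qProd_ne_zero {i d : ℕ} (c : ℤ) (hi : 0 < i) (hd : 0 < d) : qProd c i d ≠ 0 :=
  (isUnit_qProd c hi hd).ne_zero

/-- Euler's identity relating odd and distinct parts, with the multiples of five left out. -/
theorem qProd_euler_coprime_five :
    (qProd 1 2 20 * qProd 1 6 20 * qProd 1 14 20 * qProd 1 18 20) *
      (qProd (-1) 2 10 * qProd (-1) 4 10 * qProd (-1) 6 10 * qProd (-1) 8 10) = 1 := by
  have hne : qProd 1 2 10 * qProd 1 4 10 * qProd 1 6 10 * qProd 1 8 10 ≠ 0 := by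
    simp [qProd_ne_zero]
  have p2 := qProd_one_mul_neg_one 2 (d := 10) (by norm_num)
  have p4 := qProd_one_mul_neg_one 4 (d := 10) (by norm_num)
  have p6 := qProd_one_mul_neg_one 6 (d := 10) (by norm_num)
  have p8 := qProd_one_mul_neg_one 8 (d := 10) (by norm_num)
  have s2 := qProd_split 1 2 (d := 10) (by norm_num)
  have s4 := qProd_split 1 4 (d := 10) (by norm_num)
  have s6 := qProd_split 1 6 (d := 10) (by norm_num)
  have s8 := qProd_split 1 8 (d := 10) (by norm_num)
  norm_num at p2 p4 p6 p8 s2 s4 s6 s8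
  -- After multiplication by (q^2, q^4, q^6, q^8; q^10), both sides are the product over all even
  -- residues modulo 20 prime to 5.
  refine mul_left_cancel₀ hne ?_
  calc _ = (qProd 1 2 20 * qProd 1 6 20 * qProd 1 14 20 * qProd 1 18 20) *
        ((qProd 1 2 10 * qProd (-1) 2 10) * (qProd 1 4 10 * qProd (-1) 4 10) *
        (qProd 1 6 10 * qProd (-1) 6 10) * (qProd 1 8 10 * qProd (-1) 8 10)) := by ring
    _ = _ := by
      rw [p2, p4, p6, p8, s2, s4, s6, s8]
      ring

/-- Taking the class r modulo 10 commutes with multiplication by `K` and `L`, and `K` cancels in a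
domain. As r is even, passing to the even part of `F` loses nothing. -/
theorem coeff_eq_zero_of_residuePart_mul_eq {F K L T : ℤ⟦X⟧} {r : ℕ} (hr : r % 2 = 0)
    (hK : K ∈ multiplesSubring 10) (hK0 : K ≠ 0) (hL : L ∈ multiplesSubring 10)
    (h : residuePart 2 0 F * K = T * L) (hT : ∀ N, N % 10 = r → coeff N T = 0)
    {N : ℕ} (hN : N % 10 = r) : coeff N F = 0 := by
  have hT' : residuePart 10 r T = 0 := by
    ext n
    rw [coeff_residuePart, map_zero, ite_eq_right_iff]
    exact hT n
  have h1 := congrArg (residuePart 10 r) h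
  rw [residuePart_mul _ _ hK, residuePart_mul _ _ hL, hT', zero_mul] at h1
  have h2 := (mul_eq_zero.1 h1).resolve_right hK0
  have h3 := congrArg (coeff N) h2
  rwa [coeff_residuePart, if_pos hN, coeff_residuePart, if_pos (by omega), map_zero] at h3

/-- The coefficients of `1 / (q, -q², -q³, q⁴; q⁵)` at exponents `2` modulo `10` vanish. -/
theorem coeff_eq_zero_of_mul_qProd_eq_one {F : ℤ⟦X⟧}
    (hF : F * (qProd 1 1 5 * qProd (-1) 2 5 * qProd (-1) 3 5 * qProd 1 4 5) = 1)
    {N : ℕ} (hN : N % 10 = 2) : coeff N F = 0 := by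
  have p1 := qProd_one_mul_neg_one 1 (d := 10) (by norm_num)
  have p3 := qProd_one_mul_neg_one 3 (d := 10) (by norm_num)
  have p4 := qProd_one_mul_neg_one 4 (d := 10) (by norm_num)
  have p6 := qProd_one_mul_neg_one 6 (d := 10) (by norm_num)
  have p7 := qProd_one_mul_neg_one 7 (d := 10) (by norm_num)
  have p9 := qProd_one_mul_neg_one 9 (d := 10) (by norm_num)
  have s1 := qProd_split 1 1 (d := 5) (by norm_num)
  have s2 := qProd_split (-1) 2 (d := 5) (by norm_num)
  have s3 := qProd_split (-1) 3 (d := 5) (by norm_num)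
  have s4 := qProd_split 1 4 (d := 5) (by norm_num)
  have eu := qProd_euler_coprime_five
  have t1 := theta_neg_one (i := 3) (j := 7) (by norm_num) (by norm_num)
  have t2 := theta_one (i := 1) (j := 9) (by norm_num) (by norm_num)
  have t4 := theta_neg_one (i := 8) (j := 12) (by norm_num) (by norm_num)
  have t5 := theta_one (i := 4) (j := 6) (by norm_num) (by norm_num)
  norm_num at p1 p3 p4 p6 p7 p9 s1 s2 s3 s4 t1 t2 t4 t5
  rw [s1, s2, s3, s4] at hF
  have step : F * (qProd 1 4 10 * qProd 1 6 10 * qProd 1 10 10 ^ 2) =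
      theta (-1) 3 7 * theta 1 1 9 * (qProd (-1) 4 10 * qProd (-1) 6 10) := by
    rw [← p1, ← p3, ← p7, ← p9] at eu
    rw [t1, t2]
    linear_combination (-(F * (qProd 1 4 10 * qProd 1 6 10 * qProd 1 10 10 ^ 2))) * eu +
      (qProd 1 3 10 * qProd 1 7 10 * qProd 1 10 10 * (qProd (-1) 1 10 * qProd (-1) 9 10 *
        qProd 1 10 10) * (qProd (-1) 4 10 * qProd (-1) 6 10)) * hF
  have m : ∀ c i, 2 ∣ i → qProd c i 10 ∈ multiplesSubring 2 := fun c i hi =>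
    qProd_mem_multiplesSubring c (by norm_num) hi (by norm_num)
  have m10 : ∀ d, 0 < d → 10 ∣ d → qProd 1 d d ∈ multiplesSubring 10 := fun d hd h =>
    qProd_mem_multiplesSubring 1 hd h h
  have step2 := congrArg (residuePart 2 0) step
  rw [residuePart_mul _ _ (mul_mem (mul_mem (m _ _ (by norm_num)) (m _ _ (by norm_num)))
    (pow_mem (m _ _ (by norm_num)) _)), residuePart_mul _ _ (mul_mem (m _ _ (by norm_num))
    (m _ _ (by norm_num))), residuePart_theta_three_seven_mul_theta_one_nine, t4,
    ← p4, ← p6] at step2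
  refine coeff_eq_zero_of_residuePart_mul_eq (r := 2) (by norm_num)
    (K := qProd 1 10 10 ^ 4) (L := qProd 1 20 20)
    (T := theta (-1) 4 16 * (theta 1 4 6 * theta 1 4 6)) (pow_mem (m10 _ (by norm_num)
    (by norm_num)) _) (pow_ne_zero _ (qProd_ne_zero _ (by norm_num) (by norm_num)))
    (m10 _ (by norm_num) (by norm_num)) ?_
    (fun N hN => coeff_theta_four_sixteen_mul_theta_four_six_sq hN) hN
  have hne : qProd 1 4 10 * qProd 1 6 10 ≠ 0 := by simp [qProd_ne_zero]
  refine mul_left_cancel₀ hne ?_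
  rw [t5]
  -- The extra square of (q^10; q^10) completes the two copies of (-q^4, -q^6; q^10) to f(q^4,q^6)².
  linear_combination (qProd 1 10 10 ^ 2) * step2

/-- The coefficients of `1 / (-q, q², q³, -q⁴; q⁵)` at exponents `6` modulo `10` vanish. -/
theorem coeff_eq_zero_of_mul_qProd_neg_eq_one {F : ℤ⟦X⟧}
    (hF : F * (qProd (-1) 1 5 * qProd 1 2 5 * qProd 1 3 5 * qProd (-1) 4 5) = 1)
    {N : ℕ} (hN : N % 10 = 6) : coeff N F = 0 := by
  have p1 := qProd_one_mul_neg_one 1 (d := 10) (by norm_num)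
  have p3 := qProd_one_mul_neg_one 3 (d := 10) (by norm_num)
  have p2 := qProd_one_mul_neg_one 2 (d := 10) (by norm_num)
  have p8 := qProd_one_mul_neg_one 8 (d := 10) (by norm_num)
  have p7 := qProd_one_mul_neg_one 7 (d := 10) (by norm_num)
  have p9 := qProd_one_mul_neg_one 9 (d := 10) (by norm_num)
  have s1 := qProd_split (-1) 1 (d := 5) (by norm_num)
  have s2 := qProd_split 1 2 (d := 5) (by norm_num)
  have s3 := qProd_split 1 3 (d := 5) (by norm_num)
  have s4 := qProd_split (-1) 4 (d := 5) (by norm_num)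
  have eu := qProd_euler_coprime_five
  have t1 := theta_neg_one (i := 1) (j := 9) (by norm_num) (by norm_num)
  have t2 := theta_one (i := 3) (j := 7) (by norm_num) (by norm_num)
  have t3 := theta_neg_one (i := 4) (j := 16) (by norm_num) (by norm_num)
  have t5 := theta_one (i := 2) (j := 8) (by norm_num) (by norm_num)
  norm_num at p1 p3 p2 p8 p7 p9 s1 s2 s3 s4 t1 t2 t3 t5
  rw [s1, s2, s3, s4] at hF
  have step : F * (qProd 1 2 10 * qProd 1 8 10 * qProd 1 10 10 ^ 2) =
      theta (-1) 1 9 * theta 1 3 7 * (qProd (-1) 2 10 * qProd (-1) 8 10) := by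
    rw [← p1, ← p3, ← p7, ← p9] at eu
    rw [t1, t2]
    linear_combination (-(F * (qProd 1 2 10 * qProd 1 8 10 * qProd 1 10 10 ^ 2))) * eu +
      (qProd 1 1 10 * qProd 1 9 10 * qProd 1 10 10 * (qProd (-1) 3 10 * qProd (-1) 7 10 *
        qProd 1 10 10) * (qProd (-1) 2 10 * qProd (-1) 8 10)) * hF
  have m : ∀ c i, 2 ∣ i → qProd c i 10 ∈ multiplesSubring 2 := fun c i hi =>
    qProd_mem_multiplesSubring c (by norm_num) hi (by norm_num)
  have m10 : ∀ d, 0 < d → 10 ∣ d → qProd 1 d d ∈ multiplesSubring 10 := fun d hd h =>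
    qProd_mem_multiplesSubring 1 hd h h
  have step2 := congrArg (residuePart 2 0) step
  rw [residuePart_mul _ _ (mul_mem (mul_mem (m _ _ (by norm_num)) (m _ _ (by norm_num)))
    (pow_mem (m _ _ (by norm_num)) _)), residuePart_mul _ _ (mul_mem (m _ _ (by norm_num))
    (m _ _ (by norm_num))), residuePart_theta_one_nine_mul_theta_three_seven, t3,
    ← p2, ← p8] at step2
  refine coeff_eq_zero_of_residuePart_mul_eq (r := 6) (by norm_num)
    (K := qProd 1 10 10 ^ 4) (L := qProd 1 20 20)
    (T := theta (-1) 8 12 * (theta 1 2 8 * theta 1 2 8)) (pow_mem (m10 _ (by norm_num)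
    (by norm_num)) _) (pow_ne_zero _ (qProd_ne_zero _ (by norm_num) (by norm_num)))
    (m10 _ (by norm_num) (by norm_num)) ?_
    (fun N hN => coeff_theta_eight_twelve_mul_theta_two_eight_sq hN) hN
  have hne : qProd 1 2 10 * qProd 1 8 10 ≠ 0 := by simp [qProd_ne_zero]
  refine mul_left_cancel₀ hne ?_
  rw [t5]
  linear_combination (qProd 1 10 10 ^ 2) * step2

end Vanishing

end QSeries

namespace QSeries

/-! ### Splitting a product by residues modulo 5 -/

section ResidueClasses

theorem prod_range_five_mul {M : Type*} [CommMonoid M] (f : ℕ → M) (N : ℕ) :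
    ∏ k ∈ range (5 * N), f k = ∏ r ∈ range 5, ∏ n ∈ range N, f (5 * n + r) := by
  rw [Finset.prod_comm]
  induction N with
  | zero => simp
  | succ N ih => rw [mul_add, mul_one, prod_range_add, ih, prod_range_succ _ N]

/-- Comparing partial products of length 5N suffices. The generality serves both formal power series
and complex numbers. -/
theorem hasProd_eq_prod_residues {M : Type*} [CommMonoid M] [TopologicalSpace M] [ContinuousMul M]
    [T2Space M] {f : ℕ → M} {F : M} (hf : HasProd f F) {g : ℕ → M}
    (hg : ∀ r, HasProd (fun n => f (5 * n + r)) (g r)) : F = ∏ r ∈ range 5, g r := by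
  have h1 : Tendsto (fun N => ∏ k ∈ range (5 * N), f k) atTop (𝓝 F) :=
    hf.tendsto_prod_nat.comp (tendsto_id.const_mul_atTop' (by norm_num))
  have h2 : Tendsto (fun N => ∏ r ∈ range 5, ∏ n ∈ range N, f (5 * n + r)) atTop
      (𝓝 (∏ r ∈ range 5, g r)) :=
    tendsto_finsetProd _ fun r _ => (hg r).tendsto_prod_nat
  simp_rw [prod_range_five_mul] at h1
  exact tendsto_nhds_unique h1 h2

end ResidueClasses

/-! ### Weighted partitions and their Euler product -/

section PartitionSeries

/-- The expansion of `1 / (1 - a X ^ d)`. -/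
noncomputable def geomSeries (a : ℤ) (d : ℕ) : ℤ⟦X⟧ :=
  PowerSeries.mk fun n => if d ∣ n then a ^ (n / d) else 0

theorem coeff_geomSeries (a : ℤ) (d n : ℕ) :
    coeff n (geomSeries a d) = if d ∣ n then a ^ (n / d) else 0 := coeff_mk _ _

theorem one_sub_mul_geomSeries (a : ℤ) {d : ℕ} (hd : 0 < d) :
    (1 - (a : ℤ⟦X⟧) * X ^ d) * geomSeries a d = 1 := by
  ext n
  have : (1 - (a : ℤ⟦X⟧) * X ^ d) * geomSeries a d =
      geomSeries a d - C a * (X ^ d * geomSeries a d) := by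
    rw [show (C a : ℤ⟦X⟧) = (a : ℤ⟦X⟧) by simp]
    ring
  rw [this, map_sub, coeff_C_mul, coeff_X_pow_mul', coeff_geomSeries, coeff_geomSeries, coeff_one]
  rcases lt_or_ge n d with h | h
  · rw [if_neg (show ¬ d ≤ n by omega)]
    rcases Nat.eq_zero_or_pos n with rfl | hn
    · simp
    · rw [if_neg (Nat.not_dvd_of_pos_of_lt hn h), if_neg (by omega)]
      simp
  · obtain ⟨k, rfl⟩ := Nat.exists_eq_add_of_le h
    have hdk : d ∣ d + k ↔ d ∣ k := by simp
    rw [if_pos h, if_neg (show d + k ≠ 0 by omega), Nat.add_sub_cancel_left]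
    simp only [hdk]
    split_ifs with h1
    · rw [Nat.add_div_left _ hd, pow_succ']
      ring
    · ring

/-- The generating series of partitions weighted by the product of `c` over the parts. -/
noncomputable def partitionSeries (c : ℕ → ℤ) : ℤ⟦X⟧ := Nat.Partition.genFun fun i k => c i ^ k

theorem coeff_partitionSeries (c : ℕ → ℤ) (n : ℕ) :
    coeff n (partitionSeries c) = ∑ π : Nat.Partition n, (π.parts.map c).prod := by
  rw [partitionSeries, Nat.Partition.coeff_genFun]
  refine sum_congr rfl fun π _ => ?_
  rw [Finset.prod_multiset_map_count, Finsupp.prod, Multiset.toFinsupp_support]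
  simp

theorem hasProd_partitionSeries (c : ℕ → ℤ) :
    HasProd (fun i => geomSeries (c (i + 1)) (i + 1)) (partitionSeries c) := by
  suffices e : (fun i => geomSeries (c (i + 1)) (i + 1)) = fun i =>
      1 + ∑' j, C (c (i + 1) ^ (j + 1)) * (X : ℤ⟦X⟧) ^ ((i + 1) * (j + 1)) by
    rw [e]
    have h := Nat.Partition.hasProd_genFun fun i k => c i ^ k
    simp only [smul_eq_C_mul] at h
    exact h
  funext i
  have h0 : constantCoeff ((c (i + 1) : ℤ⟦X⟧) * X ^ (i + 1)) = 0 := by simp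
  have h1 := WithPiTopology.one_sub_mul_tsum_pow_of_constantCoeff_eq_zero h0
  rw [(WithPiTopology.summable_pow_of_constantCoeff_eq_zero h0).tsum_eq_zero_add] at h1
  have h2 := one_sub_mul_geomSeries (c (i + 1)) (Nat.succ_pos i)
  have hne : (1 - (c (i + 1) : ℤ⟦X⟧) * X ^ (i + 1)) ≠ 0 := left_ne_zero_of_mul_eq_one h2
  refine mul_left_cancel₀ hne (h2.trans ?_)
  refine h1.symm.trans ?_
  rw [pow_zero]
  congr 2
  refine tsum_congr fun j => ?_
  rw [mul_pow, ← pow_mul]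
  simp

theorem multipliable_one_sub_mul_X_pow (c : ℕ → ℤ) :
    Multipliable fun i => 1 - (c (i + 1) : ℤ⟦X⟧) * X ^ (i + 1) :=
  multipliable_one_sub_of_le fun n => Dvd.dvd.mul_left (pow_dvd_pow _ (Nat.le_succ n)) _

theorem partitionSeries_mul_tprod (c : ℕ → ℤ) :
    partitionSeries c * ∏' i, (1 - (c (i + 1) : ℤ⟦X⟧) * X ^ (i + 1)) = 1 := by
  have h := (multipliable_one_sub_mul_X_pow c).hasProd.mul (hasProd_partitionSeries c)
  simp_rw [one_sub_mul_geomSeries _ (Nat.succ_pos _)] at h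
  rw [mul_comm]
  exact h.unique hasProd_one

theorem partitionSeries_mul_qProd {c : ℕ → ℤ} {u v : ℤ} (h1 : ∀ n, c (5 * n + 1) = u)
    (h2 : ∀ n, c (5 * n + 2) = v) (h3 : ∀ n, c (5 * n + 3) = v) (h4 : ∀ n, c (5 * n + 4) = u)
    (h5 : ∀ n, c (5 * n + 5) = 0) :
    partitionSeries c * (qProd u 1 5 * qProd v 2 5 * qProd v 3 5 * qProd u 4 5) = 1 := by
  rw [← partitionSeries_mul_tprod c]
  congr 1
  have key := hasProd_eq_prod_residues (multipliable_one_sub_mul_X_pow c).hasProd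
    (g := fun r => ∏' n, (1 - (c (5 * n + r + 1) : ℤ⟦X⟧) * X ^ (5 * n + r + 1))) (fun r =>
      (multipliable_one_sub_of_le fun n =>
        Dvd.dvd.mul_left (pow_dvd_pow _ (by omega)) _).hasProd)
  rw [key]
  simp only [prod_range_succ, prod_range_zero, one_mul, add_assoc, Nat.reduceAdd, h1, h2,
    h3, h4, h5, Int.cast_zero, zero_mul, sub_zero, tprod_one, mul_one, qProd]
  simp only [add_comm]

end PartitionSeries

/-! ### Convergence on the unit disc -/

section Evaluation

theorem hasSum_coeff_mul {F G : ℤ⟦X⟧} {q a b : ℂ}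
    (hF : Summable fun n => ‖((coeff n F : ℤ) : ℂ) * q ^ n‖)
    (hG : Summable fun n => ‖((coeff n G : ℤ) : ℂ) * q ^ n‖)
    (ha : HasSum (fun n => ((coeff n F : ℤ) : ℂ) * q ^ n) a)
    (hb : HasSum (fun n => ((coeff n G : ℤ) : ℂ) * q ^ n) b) :
    Summable (fun n => ‖((coeff n (F * G) : ℤ) : ℂ) * q ^ n‖) ∧
      HasSum (fun n => ((coeff n (F * G) : ℤ) : ℂ) * q ^ n) (a * b) := by
  have e : (fun n => ((coeff n (F * G) : ℤ) : ℂ) * q ^ n) = fun n => ∑ kl ∈ antidiagonal n,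
      (((coeff kl.1 F : ℤ) : ℂ) * q ^ kl.1) * (((coeff kl.2 G : ℤ) : ℂ) * q ^ kl.2) := by
    ext n
    rw [coeff_mul]
    push_cast
    rw [sum_mul]
    refine sum_congr rfl fun p hp => ?_
    rw [← HasAntidiagonal.mem_antidiagonal.1 hp, pow_add]
    ring
  have hs := summable_norm_sum_mul_antidiagonal_of_summable_norm hF hG
  refine ⟨?_, ?_⟩
  · have e' : (fun n => ‖((coeff n (F * G) : ℤ) : ℂ) * q ^ n‖) = fun n => ‖∑ kl ∈ antidiagonal n,
        (((coeff kl.1 F : ℤ) : ℂ) * q ^ kl.1) * (((coeff kl.2 G : ℤ) : ℂ) * q ^ kl.2)‖ :=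
      funext fun n => congrArg norm (congrFun e n)
    rw [e']
    exact hs
  · rw [e, ← ha.tsum_eq, ← hb.tsum_eq,
      tsum_mul_tsum_eq_tsum_sum_antidiagonal_of_summable_norm hF hG]
    exact hs.of_norm.hasSum

theorem hasSum_coeff_geomSeries {a : ℤ} (ha : |a| ≤ 1) {d : ℕ} (hd : 0 < d) {q : ℂ}
    (hq : ‖q‖ < 1) : Summable (fun n => ‖((coeff n (geomSeries a d) : ℤ) : ℂ) * q ^ n‖) ∧
      HasSum (fun n => ((coeff n (geomSeries a d) : ℤ) : ℂ) * q ^ n) (1 - a * q ^ d)⁻¹ := by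
  have ha' : ‖(a : ℂ)‖ ≤ 1 := by
    rw [Complex.norm_intCast]
    exact_mod_cast ha
  constructor
  · refine Summable.of_nonneg_of_le (fun _ => norm_nonneg _) (fun n => ?_)
      (summable_geometric_of_lt_one (norm_nonneg q) hq)
    rw [norm_mul, norm_pow, coeff_geomSeries]
    refine mul_le_of_le_one_left (by positivity) ?_
    split_ifs
    · push_cast
      rw [norm_pow]
      exact pow_le_one₀ (norm_nonneg _) ha'
    · simp
  · have hlt : ‖(a : ℂ) * q ^ d‖ < 1 := by
      rw [norm_mul, norm_pow]
      exact lt_of_le_of_lt (mul_le_of_le_one_left (by positivity) ha')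
        (pow_lt_one₀ (norm_nonneg q) hq hd.ne')
    refine ((mul_right_injective₀ hd.ne').hasSum_iff ?_).1 ?_
    · intro n hn
      rw [coeff_geomSeries, if_neg]
      · simp
      · rintro ⟨k, rfl⟩
        exact hn ⟨k, rfl⟩
    · refine (hasSum_geometric_of_norm_lt_one hlt).congr_fun fun k => ?_
      rw [Function.comp_apply, coeff_geomSeries, if_pos (dvd_mul_right d k),
        Nat.mul_div_cancel_left k hd]
      push_cast
      rw [mul_pow, pow_mul]

/-- The generating series of partitions with parts at most `N`. -/
noncomputable def partialSeries (c : ℕ → ℤ) (N : ℕ) : ℤ⟦X⟧ :=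
  ∏ i ∈ range N, geomSeries (c (i + 1)) (i + 1)

theorem hasSum_coeff_partialSeries {c : ℕ → ℤ} (hc : ∀ n, |c n| ≤ 1) {q : ℂ} (hq : ‖q‖ < 1)
    (N : ℕ) : Summable (fun n => ‖((coeff n (partialSeries c N) : ℤ) : ℂ) * q ^ n‖) ∧
      HasSum (fun n => ((coeff n (partialSeries c N) : ℤ) : ℂ) * q ^ n)
        (∏ i ∈ range N, (1 - c (i + 1) * q ^ (i + 1)))⁻¹ := by
  induction N with
  | zero =>
    have e : ∀ n, ((coeff n (partialSeries c 0) : ℤ) : ℂ) * q ^ n = if n = 0 then 1 else 0 := by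
      intro n
      rw [partialSeries, range_zero, prod_empty, coeff_one]
      split_ifs with h <;> simp [h]
    simp only [e, range_zero, prod_empty, inv_one]
    refine ⟨?_, hasSum_ite_eq 0 1⟩
    refine summable_of_ne_finset_zero (s := {0}) fun n hn => ?_
    rw [if_neg (by simpa using hn), norm_zero]
  | succ N ih =>
    have h := hasSum_coeff_geomSeries (hc (N + 1)) (Nat.succ_pos N) hq
    rw [partialSeries, prod_range_succ, prod_range_succ, mul_inv]
    exact hasSum_coeff_mul ih.1 h.1 ih.2 h.2

theorem abs_coeff_partialSeries_le {c : ℕ → ℤ} (hc : ∀ n, |c n| ≤ 1) (N n : ℕ) :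
    |coeff n (partialSeries c N)| ≤ coeff n (partialSeries (fun _ => 1) N) := by
  induction N generalizing n with
  | zero =>
    rw [partialSeries, partialSeries, range_zero, prod_empty, prod_empty, coeff_one]
    split_ifs <;> simp
  | succ N ih =>
    rw [partialSeries, partialSeries, prod_range_succ, prod_range_succ, coeff_mul, coeff_mul]
    refine (abs_sum_le_sum_abs _ _).trans (sum_le_sum fun p _ => ?_)
    rw [abs_mul]
    refine mul_le_mul (ih _) ?_ (abs_nonneg _) ((abs_nonneg _).trans (ih _))
    rw [coeff_geomSeries, coeff_geomSeries]
    split_ifs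
    · rw [abs_pow, one_pow]
      exact pow_le_one₀ (abs_nonneg _) (hc _)
    · simp

theorem coeff_partialSeries_one_nonneg (N n : ℕ) : 0 ≤ coeff n (partialSeries (fun _ => 1) N) :=
  (abs_nonneg _).trans (abs_coeff_partialSeries_le (c := fun _ => 1) (fun _ => by simp) N n)

theorem monotone_coeff_partialSeries_one (n : ℕ) :
    Monotone fun N => coeff n (partialSeries (fun _ => 1) N) := by
  refine monotone_nat_of_le_succ fun N => ?_
  rw [partialSeries.eq_1 _ (N + 1), prod_range_succ, coeff_mul]
  have h := single_le_sum (f := fun p : ℕ × ℕ => coeff p.1 (partialSeries (fun _ => 1) N) *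
    coeff p.2 (geomSeries 1 (N + 1))) (s := antidiagonal n) (fun p _ => mul_nonneg
      (coeff_partialSeries_one_nonneg _ _) ?_) (show (n, 0) ∈ antidiagonal n by simp)
  · refine le_trans (le_of_eq ?_) h
    simp [coeff_geomSeries]
  · rw [coeff_geomSeries]
    split_ifs <;> simp

theorem eventually_coeff_partialSeries (c : ℕ → ℤ) (n : ℕ) :
    ∀ᶠ N in atTop, coeff n (partialSeries c N) = coeff n (partitionSeries c) := by
  obtain ⟨M₀, hM⟩ := exists_X_pow_dvd_sub (hasProd_partitionSeries c) (n + 1)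
  refine eventually_atTop.2 ⟨M₀, fun M h => ?_⟩
  have := X_pow_dvd_iff.1 (hM M h) n (by omega)
  rwa [map_sub, sub_eq_zero] at this

theorem coeff_partialSeries_one_le (N n : ℕ) : coeff n (partialSeries (fun _ => 1) N) ≤
    coeff n (partitionSeries fun _ => 1) := by
  obtain ⟨M, hM, hN⟩ := ((eventually_coeff_partialSeries (fun _ => 1) n).and
    (eventually_ge_atTop N)).exists
  rw [← hM]
  exact monotone_coeff_partialSeries_one n hN

/-- Each factor is 1 + r^(i+1)/(1 - r^(i+1)) ≤ exp(r^i/(1 - r)), and the exponents form a geometric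
series. The bound is uniform in N. -/
theorem prod_one_sub_inv_le {r : ℝ} (h0 : 0 ≤ r) (h1 : r < 1) (N : ℕ) :
    (∏ i ∈ range N, (1 - r ^ (i + 1)))⁻¹ ≤ Real.exp ((1 - r)⁻¹ * (1 - r)⁻¹) := by
  have hr : 0 < 1 - r := by linarith
  rw [← prod_inv_distrib]
  calc ∏ i ∈ range N, (1 - r ^ (i + 1))⁻¹ ≤ ∏ i ∈ range N, Real.exp (r ^ i * (1 - r)⁻¹) := by
        refine prod_le_prod (fun i _ => ?_) fun i _ => ?_
        · exact inv_nonneg.2 (sub_nonneg.2 (pow_le_one₀ h0 h1.le))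
        · have hi : 0 < 1 - r ^ (i + 1) := sub_pos.2 (pow_lt_one₀ h0 h1 (Nat.succ_ne_zero i))
          have hle : 1 - r ≤ 1 - r ^ (i + 1) := by
            have : r ^ (i + 1) ≤ r := pow_le_of_le_one h0 h1.le (Nat.succ_ne_zero i)
            linarith
          have e : (1 - r ^ (i + 1))⁻¹ = r ^ (i + 1) * (1 - r ^ (i + 1))⁻¹ + 1 := by
            field_simp
            ring
          rw [e]
          refine le_trans ?_ (Real.add_one_le_exp _)
          gcongr ?_ + 1
          exact mul_le_mul (pow_le_pow_of_le_one h0 h1.le (Nat.le_succ i))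
            (inv_anti₀ hr hle) (inv_nonneg.2 hi.le) (by positivity)
    _ = Real.exp ((∑ i ∈ range N, r ^ i) * (1 - r)⁻¹) := by
        rw [← Real.exp_sum, sum_mul]
    _ ≤ _ := by
        gcongr
        rw [← tsum_geometric_of_lt_one h0 h1]
        exact (summable_geometric_of_lt_one h0 h1).sum_le_tsum _ fun i _ => by positivity

theorem summable_coeff_partitionSeries_one {r : ℝ} (h0 : 0 ≤ r) (h1 : r < 1) :
    Summable fun n => ((coeff n (partitionSeries fun _ => 1) : ℤ) : ℝ) * r ^ n := by
  have hnn : ∀ n, (0 : ℝ) ≤ ((coeff n (partitionSeries fun _ => 1) : ℤ) : ℝ) * r ^ n := fun n =>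
    mul_nonneg (Int.cast_nonneg ((coeff_partialSeries_one_nonneg 0 n).trans
      (coeff_partialSeries_one_le 0 n))) (by positivity)
  refine summable_of_sum_range_le hnn (c := Real.exp ((1 - r)⁻¹ * (1 - r)⁻¹)) fun K => ?_
  -- For N large, the first K partition numbers are coefficients of the finite product, whose value
  -- is bounded independently of K.
  obtain ⟨N, hN⟩ := ((Filter.eventually_all_finset (range K)).2 fun n _ =>
    eventually_coeff_partialSeries (fun _ => 1) n).exists
  have hq : ‖(r : ℂ)‖ < 1 := by rwa [Complex.norm_real, Real.norm_of_nonneg h0]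
  have h := (hasSum_coeff_partialSeries (c := fun _ => 1) (fun _ => by simp) hq N).2
  have h' : HasSum (fun n => ((coeff n (partialSeries (fun _ => 1) N) : ℤ) : ℝ) * r ^ n)
      (∏ i ∈ range N, (1 - r ^ (i + 1)))⁻¹ := by
    rw [← Complex.hasSum_ofReal]
    push_cast
    simpa using h
  refine le_trans (le_of_eq ?_) ((sum_le_hasSum (range K) (fun n _ => ?_) h').trans
    (prod_one_sub_inv_le h0 h1 N))
  · exact sum_congr rfl fun n hn => by rw [hN n hn]
  · exact mul_nonneg (by exact_mod_cast coeff_partialSeries_one_nonneg N n) (by positivity)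

theorem summable_norm_intCast_mul_pow {c : ℕ → ℤ} (hc : ∀ n, |c n| ≤ 1) {q : ℂ} (hq : ‖q‖ < 1)
    (k : ℕ → ℕ) (hk : ∀ n, n ≤ k n) : Summable fun n => ‖-((c (k n) : ℂ) * q ^ k n)‖ := by
  refine Summable.of_nonneg_of_le (fun _ => norm_nonneg _) (fun n => ?_)
    (summable_geometric_of_lt_one (norm_nonneg q) hq)
  rw [norm_neg, norm_mul, norm_pow, Complex.norm_intCast]
  refine (mul_le_of_le_one_left (by positivity) (by exact_mod_cast hc _)).trans ?_
  exact pow_le_pow_of_le_one (norm_nonneg q) hq.le (hk n)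

theorem multipliable_one_sub_intCast_mul_pow {c : ℕ → ℤ} (hc : ∀ n, |c n| ≤ 1) {q : ℂ}
    (hq : ‖q‖ < 1) (k : ℕ → ℕ) (hk : ∀ n, n ≤ k n) :
    Multipliable fun n => 1 - (c (k n) : ℂ) * q ^ k n := by
  simp_rw [sub_eq_add_neg]
  exact multipliable_one_add_of_summable (summable_norm_intCast_mul_pow hc hq k hk)

/-- Evaluation of the generating product of weighted partitions on the unit disc. -/
theorem hasSum_coeff_partitionSeries {c : ℕ → ℤ} (hc : ∀ n, |c n| ≤ 1) {q : ℂ} (hq : ‖q‖ < 1) :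
    (∏' i, (1 - (c (i + 1) : ℂ) * q ^ (i + 1))) ≠ 0 ∧
      HasSum (fun n => ((coeff n (partitionSeries c) : ℤ) : ℂ) * q ^ n)
        (1 / ∏' i, (1 - (c (i + 1) : ℂ) * q ^ (i + 1))) := by
  set H := ∏' i, (1 - (c (i + 1) : ℂ) * q ^ (i + 1)) with hH
  have hb := summable_coeff_partitionSeries_one (norm_nonneg q) hq
  have hle : ∀ N n, ‖((coeff n (partialSeries c N) : ℤ) : ℂ) * q ^ n‖ ≤
      ((coeff n (partitionSeries fun _ => 1) : ℤ) : ℝ) * ‖q‖ ^ n := by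
    intro N n
    rw [norm_mul, norm_pow, Complex.norm_intCast]
    gcongr
    exact_mod_cast (abs_coeff_partialSeries_le hc N n).trans (coeff_partialSeries_one_le N n)
  have hev : ∀ n, ∀ᶠ N in atTop, ((coeff n (partialSeries c N) : ℤ) : ℂ) * q ^ n =
      ((coeff n (partitionSeries c) : ℤ) : ℂ) * q ^ n := fun n =>
    (eventually_coeff_partialSeries c n).mono fun N h => by rw [h]
  have hsum : Summable fun n => ((coeff n (partitionSeries c) : ℤ) : ℂ) * q ^ n := by
    refine Summable.of_norm_bounded hb fun n => ?_
    obtain ⟨N, hN⟩ := (hev n).exists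
    rw [← hN]
    exact hle N n
  have ht := tendsto_tsum_of_dominated_convergence (𝓕 := atTop) hb
    (fun n => tendsto_nhds_of_eventually_eq (hev n)) (Eventually.of_forall hle)
  simp_rw [fun N => (hasSum_coeff_partialSeries hc hq N).2.tsum_eq] at ht
  have hP : Tendsto (fun N => ∏ i ∈ range N, (1 - (c (i + 1) : ℂ) * q ^ (i + 1))) atTop (𝓝 H) :=
    (multipliable_one_sub_intCast_mul_pow hc hq (· + 1)
      fun n => Nat.le_succ n).hasProd.tendsto_prod_nat
  have hne : ∀ N, ∏ i ∈ range N, (1 - (c (i + 1) : ℂ) * q ^ (i + 1)) ≠ 0 := by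
    intro N
    refine prod_ne_zero_iff.2 fun i _ h => ?_
    have h1 : ‖(c (i + 1) : ℂ) * q ^ (i + 1)‖ < 1 := by
      rw [norm_mul, norm_pow, Complex.norm_intCast]
      exact lt_of_le_of_lt (mul_le_of_le_one_left (by positivity) (by exact_mod_cast hc _))
        (pow_lt_one₀ (norm_nonneg q) hq (Nat.succ_ne_zero i))
    rw [← sub_eq_zero.1 h, norm_one] at h1
    exact lt_irrefl _ h1
  -- The limit of the trivial products P_N · P_N⁻¹ = 1 shows at once that H is nonzero and that the
  -- series sums to its inverse.
  have h1 := hP.mul ht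
  simp_rw [fun N => mul_inv_cancel₀ (hne N)] at h1
  have h2 : 1 = H * _ := tendsto_nhds_unique tendsto_const_nhds h1
  have hH0 : H ≠ 0 := left_ne_zero_of_mul_eq_one h2.symm
  refine ⟨hH0, ?_⟩
  rw [one_div, ← eq_inv_of_mul_eq_one_right h2.symm]
  exact hsum.hasSum

end Evaluation

end QSeries

/-! ### Specialization to the Legendre symbol modulo 5 -/

namespace LegendrePartitions

theorem chi5_eq_of_mod_eq {m n : ℕ} (h : m % 5 = n % 5) : chi5 m = chi5 n := by
  rw [chi5, chi5, legendreSym.mod 5 (m : ℤ), legendreSym.mod 5 (n : ℤ)]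
  congr 1
  exact_mod_cast h

theorem chi5_five_mul_add (n r : ℕ) : chi5 (5 * n + r) = chi5 r :=
  chi5_eq_of_mod_eq (by omega)

theorem chi5_one : chi5 1 = 1 := by simp [chi5]

theorem chi5_two : chi5 2 = -1 := by
  rw [chi5, legendreSym.eq_neg_one_iff]
  decide

theorem chi5_three : chi5 3 = -1 := by
  rw [chi5, legendreSym.eq_neg_one_iff]
  decide

theorem chi5_four : chi5 4 = 1 := by
  rw [chi5, legendreSym.eq_one_iff _ (by decide)]
  decide

theorem chi5_five : chi5 5 = 0 := by
  rw [chi5, legendreSym.eq_zero_iff]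
  decide

theorem abs_chi5_le_one (n : ℕ) : |chi5 n| ≤ 1 := by
  by_cases h : ((n : ℤ) : ZMod 5) = 0
  · rw [chi5, (legendreSym.eq_zero_iff 5 _).2 h]
    simp
  · rcases legendreSym.eq_one_or_neg_one 5 h with h | h <;> rw [chi5, h] <;> simp

theorem coeff_partitionSeries_chi5 (n : ℕ) : coeff n (QSeries.partitionSeries chi5) = p5 n :=
  QSeries.coeff_partitionSeries _ _

theorem coeff_partitionSeries_neg_chi5 (n : ℕ) :
    coeff n (QSeries.partitionSeries fun k => -chi5 k) = p5Dagger n := by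
  rw [QSeries.coeff_partitionSeries, p5Dagger]
  refine sum_congr rfl fun π _ => ?_
  have e : (fun k => -chi5 k) = fun k => (-1) * chi5 k := by
    ext k
    ring
  rw [e, Multiset.prod_map_mul, Multiset.map_const', Multiset.prod_replicate]

theorem p5_eq_zero {n : ℕ} (hn : n % 10 = 2) : p5 n = 0 := by
  rw [← coeff_partitionSeries_chi5]
  refine QSeries.coeff_eq_zero_of_mul_qProd_eq_one
    (QSeries.partitionSeries_mul_qProd ?_ ?_ ?_ ?_ ?_) hn <;> intro k
  · rw [chi5_five_mul_add, chi5_one]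
  · rw [chi5_five_mul_add, chi5_two]
  · rw [chi5_five_mul_add, chi5_three]
  · rw [chi5_five_mul_add, chi5_four]
  · rw [chi5_five_mul_add, chi5_five]

theorem p5Dagger_eq_zero {n : ℕ} (hn : n % 10 = 6) : p5Dagger n = 0 := by
  rw [← coeff_partitionSeries_neg_chi5]
  refine QSeries.coeff_eq_zero_of_mul_qProd_neg_eq_one
    (QSeries.partitionSeries_mul_qProd ?_ ?_ ?_ ?_ ?_) hn <;> intro k
  · rw [chi5_five_mul_add, chi5_one]
  · rw [chi5_five_mul_add, chi5_two, neg_neg]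
  · rw [chi5_five_mul_add, chi5_three, neg_neg]
  · rw [chi5_five_mul_add, chi5_four]
  · rw [chi5_five_mul_add, chi5_five, neg_zero]

theorem tprod_eq_prod_residues {c : ℕ → ℤ} (hc : ∀ n, |c n| ≤ 1) {q : ℂ} (hq : ‖q‖ < 1) :
    ∏' i, (1 - (c (i + 1) : ℂ) * q ^ (i + 1)) =
      ∏ r ∈ range 5, ∏' n, (1 - (c (5 * n + (r + 1)) : ℂ) * q ^ (5 * n + (r + 1))) :=
  QSeries.hasProd_eq_prod_residues
    (QSeries.multipliable_one_sub_intCast_mul_pow hc hq (· + 1) fun n => Nat.le_succ n).hasProd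
    fun r => (QSeries.multipliable_one_sub_intCast_mul_pow hc hq (fun n => 5 * n + (r + 1))
      fun n => by omega).hasProd

theorem tprod_eq_qPoch (u q : ℂ) (r : ℕ) :
    ∏' n : ℕ, (1 - u * q ^ (5 * n + r)) = qPoch (u * q ^ r) (q ^ 5) := by
  rw [qPoch]
  refine tprod_congr fun n => ?_
  rw [pow_add, pow_mul]
  ring

theorem qPoch_zero (q : ℂ) : qPoch 0 q = 1 := by simp [qPoch]

theorem tprod_chi5_eq_X {q : ℂ} (hq : ‖q‖ < 1) :
    ∏' i, (1 - (chi5 (i + 1) : ℂ) * q ^ (i + 1)) = X q := by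
  rw [tprod_eq_prod_residues abs_chi5_le_one hq]
  simp only [prod_range_succ, prod_range_zero, one_mul, zero_add, Nat.reduceAdd,
    chi5_five_mul_add, tprod_eq_qPoch]
  simp [chi5_one, chi5_two, chi5_three, chi5_four, chi5_five, qPoch_zero, X]

theorem tprod_neg_chi5_eq_Y {q : ℂ} (hq : ‖q‖ < 1) :
    ∏' i, (1 - ((-chi5 (i + 1) : ℤ) : ℂ) * q ^ (i + 1)) = Y q := by
  rw [tprod_eq_prod_residues (c := fun k => -chi5 k) (fun n => by
    rw [abs_neg]; exact abs_chi5_le_one n) hq]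
  simp only [prod_range_succ, prod_range_zero, one_mul, zero_add, Nat.reduceAdd,
    chi5_five_mul_add, tprod_eq_qPoch]
  simp [chi5_one, chi5_two, chi5_three, chi5_four, chi5_five, qPoch_zero, Y]

theorem X_ne_zero_and_hasSum {q : ℂ} (hq : ‖q‖ < 1) :
    X q ≠ 0 ∧ HasSum (fun n : ℕ => (p5 n : ℂ) * q ^ n) (1 / X q) := by
  have h := QSeries.hasSum_coeff_partitionSeries abs_chi5_le_one hq
  rw [tprod_chi5_eq_X hq] at h
  simpa only [coeff_partitionSeries_chi5] using h

theorem Y_ne_zero_and_hasSum {q : ℂ} (hq : ‖q‖ < 1) :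
    Y q ≠ 0 ∧ HasSum (fun n : ℕ => (p5Dagger n : ℂ) * q ^ n) (1 / Y q) := by
  have h := QSeries.hasSum_coeff_partitionSeries (c := fun k => -chi5 k) (fun n => by
    rw [abs_neg]; exact abs_chi5_le_one n) hq
  rw [tprod_neg_chi5_eq_Y hq] at h
  simpa only [coeff_partitionSeries_neg_chi5] using h

/-- Uniqueness of power series expansions. The radius is at least 1 because the terms a_n r^n tend
to 0 for every r < 1. -/
theorem qCoeff_eq_of_hasSum {f : ℂ → ℂ} {a : ℕ → ℂ}
    (h : ∀ q : ℂ, ‖q‖ < 1 → HasSum (fun n => a n * q ^ n) (f q)) (n : ℕ) : qCoeff f n = a n := by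
  have hp : HasFPowerSeriesOnBall f (FormalMultilinearSeries.ofScalars ℂ a) 0 1 := by
    refine ⟨?_, one_pos, fun {y} hy => ?_⟩
    · refine ENNReal.le_of_forall_nnreal_lt fun r hr => ?_
      have hr : (r : ℝ) < 1 := by exact_mod_cast hr
      have hs := (h (r : ℝ) (by simpa using hr)).summable
      refine FormalMultilinearSeries.le_radius_of_tendsto _ (l := 0) ?_
      have := hs.tendsto_atTop_zero.norm
      simpa [FormalMultilinearSeries.ofScalars_norm] using this
    · have hy : ‖y‖ < 1 := by
        have : ‖y‖ₑ < 1 := by simpa using hy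
        rwa [← ofReal_norm, ENNReal.ofReal_lt_one] at this
      rw [zero_add]
      refine (h y hy).congr_fun fun n => ?_
      simp [mul_comm]
  have h1 := hp.hasFPowerSeriesAt.analyticAt.hasFPowerSeriesAt
  have h2 := h1.eq_formalMultilinearSeries hp.hasFPowerSeriesAt
  have h3 := congrArg (fun p => FormalMultilinearSeries.coeff p n) h2
  simpa [qCoeff, FormalMultilinearSeries.coeff_ofScalars] using h3

theorem component_eq_zero {f : ℂ → ℂ} {a : ℕ → ℤ} {r : ℕ}
    (h : ∀ q : ℂ, ‖q‖ < 1 → HasSum (fun n => (a n : ℂ) * q ^ n) (f q))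
    (ha : ∀ j, a (10 * j + r) = 0) (q : ℂ) : component f r q = 0 := by
  simp [component, qCoeff_eq_of_hasSum h, ha]

end LegendrePartitions

theorem theorem1 :
    -- the vanishing of the coefficients
    (∀ j : ℕ, LegendrePartitions.p5 (10 * j + 2) = 0) ∧
    (∀ j : ℕ, LegendrePartitions.p5Dagger (10 * j + 6) = 0) ∧
    -- on the unit disc, `1 / X` and `1 / Y` are the generating series of the two sequences
    (∀ q : ℂ, ‖q‖ < 1 →
      LegendrePartitions.X q ≠ 0 ∧
      HasSum (fun n : ℕ => (LegendrePartitions.p5 n : ℂ) * q ^ n) (1 / LegendrePartitions.X q) ∧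
      LegendrePartitions.Y q ≠ 0 ∧
      HasSum (fun n : ℕ => (LegendrePartitions.p5Dagger n : ℂ) * q ^ n)
        (1 / LegendrePartitions.Y q)) ∧
    -- the vanishing of the type-10 components
    (∀ q : ℂ, ‖q‖ < 1 →
      LegendrePartitions.component (fun z => 1 / LegendrePartitions.X z) 2 q = 0 ∧
      LegendrePartitions.component (fun z => 1 / LegendrePartitions.Y z) 6 q = 0) := by
  have hp : ∀ j : ℕ, LegendrePartitions.p5 (10 * j + 2) = 0 := fun j =>
    LegendrePartitions.p5_eq_zero (by omega)
  have hd : ∀ j : ℕ, LegendrePartitions.p5Dagger (10 * j + 6) = 0 := fun j =>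
    LegendrePartitions.p5Dagger_eq_zero (by omega)
  refine ⟨hp, hd, fun q hq => ?_, fun q _ => ⟨?_, ?_⟩⟩
  · have h1 := LegendrePartitions.X_ne_zero_and_hasSum hq
    have h2 := LegendrePartitions.Y_ne_zero_and_hasSum hq
    exact ⟨h1.1, h1.2, h2.1, h2.2⟩
  · exact LegendrePartitions.component_eq_zero
      (fun z hz => (LegendrePartitions.X_ne_zero_and_hasSum hz).2) hp q
  · exact LegendrePartitions.component_eq_zero
      (fun z hz => (LegendrePartitions.Y_ne_zero_and_hasSum hz).2) hd q
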